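/- Let $f:\mathbb{R}^d\to\mathbb{R}$ be locally Lipschitz and subdifferentially polynomially bounded (SPB) with parameters $R_1\ge 0$, $R_2>0$ and an integer $m\ge 1$, i.e. $R_1=0$ if and only if $m=0$ (so that here $R_1>0$), and $$\sup_{\zeta\in\partial_C f(x)}\|\zeta\|\le R_1\|x\|^m+R_2\qquad\text{for all }x\in\mathbb{R}^d,$$ where $\partial_C f$ is the Clarke subdifferential. Let $\mathcal{S}=\arg\min_{u\in\mathbb{R}^d} f(u)$ be nonempty and bounded, and suppose that there is $\mu>0$ with $$f(x)-\inf f\ \ge\ \frac{\mu}{2}\,\mathrm{dist}(x,\mathcal{S})^2\qquad\text{for all }x\in\mathbb{R}^d.$$ Let $\sigma>0$ and let $f_\sigma(x)=\mathbb{E}_{u\sim\mathcal{N}(0,I)}[f(x+\sigma u)]$ be the Gaussian smoothing of $f$. Let $\gamma\in(0,1]$, let $T$ be a positive integer, and let $\tau_k=\gamma/\sqrt{T+1}$ for $k=0,\dots,T$. Given $x^0\in\mathbb{R}^d$ and independent $u^0,u^1,\ldots\sim\mathcal{N}(0,I)$, let $$v^k=\frac{f(x^k+\sigma u^k)-f(x^k)}{\sigma}\,u^k,\qquad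 x^{k+1}=x^k-\tau_k\,\frac{v^k}{\|x^k\|^{2m}+1}.$$ Put $$\mathcal{A}=2^{2m-2}R_1\sigma^{m-1}(m+1+d)^{\frac{m+1}{2}}+\sigma^{-1}R_2\sqrt d,\quad \mathcal{B}=2^{2m-2}\sigma^{-1}R_1\sqrt d,\quad \mathcal{C}=2^{m-1}\sigma^{-1}R_1\sqrt d,$$ $$\mathcal{M}(x)=(2^{m-1}R_1\|x\|^m+R_2)\sqrt d+2^{m-1}R_1\sigma^m(m+1+d)^{\frac{m+1}{2}},$$ and, for integers $p\ge 1$, $$\mathcal{H}_{(p)}=3^{p-1}\max\Big\{2^{(m-1)p}R_1^p(2p+d)^p,\ R_2^p(2p+d)^p+2^{(m-1)p}R_1^p\sigma^{mp}[(m+2)p+d]^{\frac{(m+2)p}{2}}\Big\},$$ $$\widetilde C_\Omega=\frac1\gamma\Big[f(x^0)-\inf f+\mathcal{M}(x^0)\sigma+\frac{\mathcal{H}_{(2)}(\mathcal{A}+\mathcal{B})}{2}\gamma^2+\frac{\mathcal{H}_{(m+2)}\,\mathcal{C}}{m+2}\gamma^{m+2}\Big],$$ $$\widetilde M_\Omega=8\mu^{-1}\Big[\gamma\widetilde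 C_\Omega+\tfrac12\mu\sigma^2 d\Big]+2\sup_{w\in\mathcal{S}}\|w\|^2,\qquad \widetilde w_k^2=\mathbb{E}\bigg[\Big\|\frac{\nabla f_\sigma(x^k)}{\|x^k\|^m+1}\Big\|^2\bigg].$$ Then $f_\sigma$ is well defined and differentiable on $\mathbb{R}^d$ with $\nabla f_\sigma(x)=\sigma^{-1}\mathbb{E}_{u\sim\mathcal{N}(0,I)}[f(x+\sigma u)u]$, the expectations above and below are finite, and $$\mathbb{E}\big[\|x^{k_*}\|^2\big]\le\widetilde M_\Omega\qquad\text{for every }k_*\in\arg\min_{0\le k\le T}\widetilde w_k^2,$$ $$\min_{0\le k\le T}\mathbb{E}\Big[\|\nabla f_\sigma(x^k)\|^{\frac{1}{2\lceil m/2\rceil}}\Big]\le 2^{\frac{1}{2\lceil m/2\rceil}}\Big(1+\sqrt{\widetilde M_\Omega}\Big)\,\widetilde C_\Omega^{\frac{1}{4\lceil m/2\rceil}}\,T^{-\frac{1}{8\lceil m/2\rceil}}.$$ -/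

import Mathlib

open MeasureTheory ProbabilityTheory Filter Topology

noncomputable section

/-- The Clarke directional derivative `f°(x; v)`, the limit superior of `(f (x' + t v) - f x') / t`
as `x' → x` and `t ↓ 0`. (For a locally Lipschitz `f` the quotients are bounded near `x`, so that
the real-valued `limsup` is the genuine one.) -/
def clarkeDirDeriv {d : ℕ} (f : EuclideanSpace ℝ (Fin d) → ℝ) (x v : EuclideanSpace ℝ (Fin d)) :
    ℝ :=
  limsup (fun p : EuclideanSpace ℝ (Fin d) × ℝ => (f (p.1 + p.2 • v) - f p.1) / p.2)
    (𝓝 x ×ˢ 𝓝[>] (0 : ℝ))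

/-- The Clarke subdifferential of `f` at `x`. -/
def clarkeSubdiff {d : ℕ} (f : EuclideanSpace ℝ (Fin d) → ℝ) (x : EuclideanSpace ℝ (Fin d)) :
    Set (EuclideanSpace ℝ (Fin d)) :=
  {s | ∀ v, inner ℝ s v ≤ clarkeDirDeriv f x v}

/-- `f` is subdifferentially polynomially bounded with parameters `R₁`, `R₂` and `m`. -/
structure IsSPB {d : ℕ} (f : EuclideanSpace ℝ (Fin d) → ℝ) (R₁ R₂ : ℝ) (m : ℕ) : Prop where
  locallyLipschitz : LocallyLipschitz f
  R₁_nonneg : 0 ≤ R₁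
  R₂_pos : 0 < R₂
  R₁_eq_zero_iff : R₁ = 0 ↔ m = 0
  bound : ∀ x, ∀ ζ ∈ clarkeSubdiff f x, ‖ζ‖ ≤ R₁ * ‖x‖ ^ m + R₂

/-- The Gaussian smoothing `f_σ(x) = E[f(x + σ u)]`, where `u` is standard Gaussian on `ℝᵈ`. -/
def gaussianSmoothing {d : ℕ} (f : EuclideanSpace ℝ (Fin d) → ℝ) (σ : ℝ)
    (x : EuclideanSpace ℝ (Fin d)) : ℝ :=
  ∫ u, f (x + σ • u) ∂(stdGaussian (EuclideanSpace ℝ (Fin d)))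

/-- The iterates of the zeroth-order algorithm, for a given realization `u` of the directions:
`x⁰ = x0` and `xᵏ⁺¹ = xᵏ - τₖ vᵏ / (‖xᵏ‖^(2m) + 1)` with `vᵏ = σ⁻¹ (f(xᵏ + σ uᵏ) - f(xᵏ)) uᵏ`. -/
def zoIterate {d : ℕ} (f : EuclideanSpace ℝ (Fin d) → ℝ) (m : ℕ) (σ : ℝ) (τ : ℕ → ℝ)
    (x0 : EuclideanSpace ℝ (Fin d)) (u : ℕ → EuclideanSpace ℝ (Fin d)) :
    ℕ → EuclideanSpace ℝ (Fin d)
  | 0 => x0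
  | k + 1 =>
    let x := zoIterate f m σ τ x0 u k
    let v := ((f (x + σ • u k) - f x) / σ) • u k
    x - (τ k / (‖x‖ ^ (2 * m) + 1)) • v

/-- The constant `𝒜`. -/
def constA (d m : ℕ) (R₁ R₂ σ : ℝ) : ℝ :=
  (2 : ℝ) ^ (2 * (m : ℤ) - 2) * R₁ * σ ^ ((m : ℤ) - 1) * ((m : ℝ) + 1 + d) ^ (((m : ℝ) + 1) / 2)
    + σ⁻¹ * R₂ * √(d : ℝ)

/-- The constant `ℬ`. -/
def constB (d m : ℕ) (R₁ σ : ℝ) : ℝ :=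
  (2 : ℝ) ^ (2 * (m : ℤ) - 2) * σ⁻¹ * R₁ * √(d : ℝ)

/-- The constant `𝒞`. -/
def constC (d m : ℕ) (R₁ σ : ℝ) : ℝ :=
  (2 : ℝ) ^ ((m : ℤ) - 1) * σ⁻¹ * R₁ * √(d : ℝ)

/-- The function `ℳ`. -/
def constM {d : ℕ} (m : ℕ) (R₁ R₂ σ : ℝ) (x : EuclideanSpace ℝ (Fin d)) : ℝ :=
  ((2 : ℝ) ^ ((m : ℤ) - 1) * R₁ * ‖x‖ ^ m + R₂) * √(d : ℝ)
    + (2 : ℝ) ^ ((m : ℤ) - 1) * R₁ * σ ^ m * ((m : ℝ) + 1 + d) ^ (((m : ℝ) + 1) / 2)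

/-- The constant `ℋ₍ₚ₎`. -/
def constH (d m : ℕ) (R₁ R₂ σ : ℝ) (p : ℕ) : ℝ :=
  if p = 0 then 1 else
    (3 : ℝ) ^ (p - 1) *
      max ((2 : ℝ) ^ (((m : ℤ) - 1) * p) * R₁ ^ p * (2 * (p : ℝ) + d) ^ p)
        (R₂ ^ p * (2 * (p : ℝ) + d) ^ p
          + (2 : ℝ) ^ (((m : ℤ) - 1) * p) * R₁ ^ p * σ ^ (m * p)
            * (((m : ℝ) + 2) * p + d) ^ ((((m : ℝ) + 2) * p) / 2))

/-- The set `𝒮` of global minimizers of `f`. -/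
def minimizers {d : ℕ} (f : EuclideanSpace ℝ (Fin d) → ℝ) : Set (EuclideanSpace ℝ (Fin d)) :=
  {x | ∀ y, f x ≤ f y}

/-- The constant `C̃_Ω`. -/
def constCtilde {d : ℕ} (f : EuclideanSpace ℝ (Fin d) → ℝ) (m : ℕ) (R₁ R₂ σ γ : ℝ)
    (x0 : EuclideanSpace ℝ (Fin d)) : ℝ :=
  1 / γ * (f x0 - (⨅ u, f u) + constM m R₁ R₂ σ x0 * σ
    + constH d m R₁ R₂ σ 2 * (constA d m R₁ R₂ σ + constB d m R₁ σ) / 2 * γ ^ 2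
    + constH d m R₁ R₂ σ (m + 2) * constC d m R₁ σ / ((m : ℝ) + 2) * γ ^ (m + 2))

/-- The constant `M̃_Ω`. -/
def constMtilde {d : ℕ} (f : EuclideanSpace ℝ (Fin d) → ℝ) (m : ℕ) (R₁ R₂ σ γ μ : ℝ)
    (x0 : EuclideanSpace ℝ (Fin d)) : ℝ :=
  8 * μ⁻¹ * (γ * constCtilde f m R₁ R₂ σ γ x0 + 1 / 2 * μ * σ ^ 2 * d)
    + 2 * ⨆ w : minimizers f, ‖(w : EuclideanSpace ℝ (Fin d))‖ ^ 2

end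

/-! The proof is a stochastic descent analysis of `f_σ`, which is differentiable although `f` need
not be. A mean value inequality for the Clarke derivative turns the SPB bound into a polynomial
bound on `|f (x + v) - f x|` (`IsSPB.abs_sub_le`). By the Cameron–Martin formula a shift of `x`
moves onto the Gaussian weight; hence `f_σ` has a gradient, this gradient is the mean of the search
direction, and its increments satisfy a Lipschitz-type estimate with polynomially growing modulus
(`IsSPB.norm_smoothingGradient_sub_le`). The resulting descent lemma has remainders of degree `2`
and `m + 2` in the step.

Dividing the step by `‖x‖ ^ (2 * m) + 1` bounds the mean of both remainders uniformly in `x`; the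
price is that the decrease is measured by the scaled gradient `∇f_σ / (‖x‖ ^ m + 1)`. Each iterate
is independent of the direction drawn there, so the one-step inequality can be averaged and
telescoped; over `T + 1` steps of size `γ / √(T + 1)` the remainders stay bounded
(`IsSPB.integral_gaussianSmoothing_add_sum_le`).

This has two consequences. The mean of `f_σ` stays bounded along the iterates, so quadratic growth
bounds `E‖x^k‖²` for every `k ≤ T` (`IsSPB.integral_norm_iterate_sq_le`). And the smallest mean
squared scaled gradient is `O(T^(-1/2))` (`IsSPB.integral_norm_scaledGradient_sq_le`). To undo the
scaling, the gradient norm is written as scaled norm times `‖x‖ ^ m + 1` and raised to the power `q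
= 1 / (2⌈m/2⌉)`; Cauchy–Schwarz and Jensen separate the factors. Since `m q ≤ 1`, the factor in `x`
costs only a second moment. -/

/-! ### Density, translation formula and moments of the standard Gaussian. -/

section GaussianMeasure

variable {E : Type*} [NormedAddCommGroup E] [InnerProductSpace ℝ E]

/-- The density of the standard Gaussian measure with respect to the Lebesgue measure. -/
noncomputable def stdGaussianPDF (x : E) : ℝ :=
  (2 * Real.pi) ^ (-(Module.finrank ℝ E : ℝ) / 2) * Real.exp (-(1 / 2) * ‖x‖ ^ 2)

theorem stdGaussianPDF_nonneg (x : E) : 0 ≤ stdGaussianPDF x := by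
  unfold stdGaussianPDF; positivity

theorem continuous_stdGaussianPDF : Continuous (stdGaussianPDF : E → ℝ) := by
  unfold stdGaussianPDF; fun_prop

variable [FiniteDimensional ℝ E] [MeasurableSpace E] [BorelSpace E]

theorem integrable_stdGaussianPDF : Integrable (stdGaussianPDF : E → ℝ) := by
  unfold stdGaussianPDF
  refine Integrable.const_mul ?_ _
  have h := (GaussianFourier.integrable_cexp_neg_mul_sq_norm_add (V := E) (b := (1 / 2 : ℂ))
    (by norm_num) 0 0).norm
  refine h.congr (Eventually.of_forall fun x => ?_)
  simp only [Complex.norm_exp]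
  congr 1
  rw [← Complex.ofReal_pow]
  simp [-Complex.ofReal_pow]

/-- Both sides are finite measures with the same characteristic function. The Lebesgue density is
what gives access to translations and polar coordinates. -/
theorem stdGaussian_eq_withDensity :
    stdGaussian E = volume.withDensity (fun x => ENNReal.ofReal (stdGaussianPDF x)) := by
  have : IsFiniteMeasure
      ((volume : Measure E).withDensity (fun x => ENNReal.ofReal (stdGaussianPDF x))) :=
    isFiniteMeasure_withDensity_ofReal integrable_stdGaussianPDF.2
  apply Measure.ext_of_charFun
  ext t
  rw [charFun_stdGaussian, charFun_apply, integral_withDensity_eq_integral_toReal_smul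
    (by have := continuous_stdGaussianPDF (E := E); fun_prop) (by simp)]
  have h := GaussianFourier.integral_cexp_neg_mul_sq_norm_add (V := E) (b := (1 / 2 : ℂ))
    (by norm_num) Complex.I t
  have h1 : ∀ x : E, (ENNReal.ofReal (stdGaussianPDF x)).toReal •
      Complex.exp (inner ℝ x t * Complex.I) =
      ((2 * Real.pi : ℝ) ^ (-(Module.finrank ℝ E : ℝ) / 2) : ℝ) *
        Complex.exp (-(1 / 2) * ‖x‖ ^ 2 + Complex.I * inner ℝ t x) := by
    intro x
    rw [ENNReal.toReal_ofReal (stdGaussianPDF_nonneg x), stdGaussianPDF, Complex.real_smul,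
      Complex.exp_add, real_inner_comm]
    push_cast
    ring_nf
  simp_rw [h1]
  rw [integral_const_mul, h]
  have h2 : ((Real.pi : ℂ) / (1 / 2)) ^ (Module.finrank ℝ E / 2 : ℂ) =
      (((2 * Real.pi : ℝ) ^ ((Module.finrank ℝ E : ℝ) / 2) : ℝ) : ℂ) := by
    rw [Complex.ofReal_cpow (by positivity)]
    push_cast
    ring_nf
  rw [h2, ← mul_assoc, ← Complex.ofReal_mul, ← Real.rpow_add (by positivity)]
  have h3 : -(Module.finrank ℝ E : ℝ) / 2 + Module.finrank ℝ E / 2 = 0 := by ring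
  rw [h3]
  simp
  ring_nf

theorem integral_stdGaussian {F : Type*} [NormedAddCommGroup F] [NormedSpace ℝ F] (g : E → F) :
    ∫ x, g x ∂stdGaussian E = ∫ x, stdGaussianPDF x • g x := by
  rw [stdGaussian_eq_withDensity, integral_withDensity_eq_integral_toReal_smul
    (by have := continuous_stdGaussianPDF (E := E); fun_prop) (by simp)]
  simp_rw [ENNReal.toReal_ofReal (stdGaussianPDF_nonneg _)]

/-- The Cameron–Martin formula for the standard Gaussian measure. -/
theorem integral_stdGaussian_add {F : Type*} [NormedAddCommGroup F] [NormedSpace ℝ F]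
    (g : E → F) (h : E) :
    ∫ x, g (x + h) ∂stdGaussian E =
      ∫ x, Real.exp (inner ℝ x h - ‖h‖ ^ 2 / 2) • g x ∂stdGaussian E := by
  rw [integral_stdGaussian, integral_stdGaussian,
    ← integral_sub_right_eq_self (fun x => stdGaussianPDF x • g (x + h)) h]
  refine integral_congr_ae (Eventually.of_forall fun x => ?_)
  simp only [sub_add_cancel, smul_smul, stdGaussianPDF]
  rw [mul_assoc, ← Real.exp_add, norm_sub_sq_real]
  ring_nf

theorem integrable_norm_pow_stdGaussian (p : ℕ) :
    Integrable (fun x : E => ‖x‖ ^ p) (stdGaussian E) := by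
  simpa using (IsGaussian.memLp_id (stdGaussian E) p (by simp)).integrable_norm_pow'

/-- This is the functional equation `Γ(s + 1) = s Γ(s)` at `s = (n + 1) / 2`. -/
theorem integral_Ioi_pow_mul_exp_recurrence (n : ℕ) :
    ∫ y in Set.Ioi (0 : ℝ), y ^ (n + 2) * Real.exp (-(1 / 2) * y ^ 2) =
      (n + 1) * ∫ y in Set.Ioi (0 : ℝ), y ^ n * Real.exp (-(1 / 2) * y ^ 2) := by
  have key : ∀ k : ℕ, ∫ y in Set.Ioi (0 : ℝ), y ^ k * Real.exp (-(1 / 2) * y ^ 2) =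
      (1 / 2 : ℝ) ^ (-((k : ℝ) + 1) / 2) * (1 / 2) * Real.Gamma (((k : ℝ) + 1) / 2) := by
    intro k
    rw [← integral_rpow_mul_exp_neg_mul_rpow (p := 2) (q := k) (b := 1 / 2) (by norm_num)
      (by have : (0 : ℝ) ≤ k := k.cast_nonneg
          linarith) (by norm_num)]
    refine setIntegral_congr_fun measurableSet_Ioi fun y _ => ?_
    simp [Real.rpow_natCast]
  rw [key, key]
  have h1 : (((n + 2 : ℕ) : ℝ) + 1) / 2 = ((n : ℝ) + 1) / 2 + 1 := by push_cast; ring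
  have h2 : -(((n + 2 : ℕ) : ℝ) + 1) / 2 = -((n : ℝ) + 1) / 2 + (-1) := by push_cast; ring
  rw [h1, h2, Real.Gamma_add_one (by positivity), Real.rpow_add (by norm_num), Real.rpow_neg_one]
  ring

/-- In polar coordinates both moments are the same constant times a radial integral, so the volume
of the ball never has to be computed. Dimension zero is separate because the radial exponent
`finrank - 1` truncates there. -/
theorem integral_norm_pow_stdGaussian_recurrence (p : ℕ) :
    ∫ x, ‖x‖ ^ (p + 2) ∂stdGaussian E =
      (p + Module.finrank ℝ E) * ∫ x, ‖x‖ ^ p ∂stdGaussian E := by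
  rcases subsingleton_or_nontrivial E with hE | hE
  · have h0 : ∀ x : E, ‖x‖ = 0 := fun x => by rw [Subsingleton.elim x 0, norm_zero]
    simp only [h0, Module.finrank_zero_of_subsingleton]
    rcases Nat.eq_zero_or_pos p with rfl | hp
    · simp
    · simp [hp.ne']
  · have key : ∀ k : ℕ, ∫ x, ‖x‖ ^ k ∂stdGaussian E =
        (2 * Real.pi) ^ (-(Module.finrank ℝ E : ℝ) / 2) * (Module.finrank ℝ E *
          ((volume : Measure E).real (Metric.ball 0 1) *
            ∫ y in Set.Ioi (0 : ℝ),
              y ^ (Module.finrank ℝ E - 1 + k) * Real.exp (-(1 / 2) * y ^ 2))) := by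
      intro k
      rw [integral_stdGaussian]
      simp only [stdGaussianPDF, smul_eq_mul, mul_assoc]
      rw [integral_const_mul, integral_fun_norm_addHaar volume
        (fun r : ℝ => Real.exp (-(1 / 2) * r ^ 2) * r ^ k)]
      simp only [nsmul_eq_mul, smul_eq_mul]
      congr 4
      ext y
      ring
    rw [key, key, ← add_assoc, integral_Ioi_pow_mul_exp_recurrence]
    have : ((Module.finrank ℝ E - 1 + p : ℕ) : ℝ) + 1 = p + Module.finrank ℝ E := by
      have := Module.finrank_pos (R := ℝ) (M := E)
      have h : Module.finrank ℝ E - 1 + p + 1 = p + Module.finrank ℝ E := by omega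
      exact_mod_cast h
    rw [this]
    ring

theorem integral_norm_sq_stdGaussian :
    ∫ x, ‖x‖ ^ 2 ∂stdGaussian E = Module.finrank ℝ E := by
  simpa using integral_norm_pow_stdGaussian_recurrence (E := E) 0

/-- Nonnegativity of the variance of the norm, whose second moment is the dimension. -/
theorem integral_norm_stdGaussian_le :
    ∫ x, ‖x‖ ∂stdGaussian E ≤ √(Module.finrank ℝ E : ℝ) := by
  apply Real.le_sqrt_of_sq_le
  rw [← integral_norm_sq_stdGaussian]
  have h := variance_nonneg (fun x : E => ‖id x‖) (stdGaussian E)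
  rw [variance_eq_sub (IsGaussian.memLp_two_id (μ := stdGaussian E)).norm] at h
  simpa using h

theorem integral_norm_pow_stdGaussian_le (p : ℕ) :
    ∫ x, ‖x‖ ^ p ∂stdGaussian E ≤ ((p : ℝ) + Module.finrank ℝ E) ^ ((p : ℝ) / 2) := by
  induction p using Nat.twoStepInduction with
  | zero => simp
  | one =>
    simp only [pow_one, Nat.cast_one]
    refine integral_norm_stdGaussian_le.trans ?_
    rw [← Real.sqrt_eq_rpow]
    exact Real.sqrt_le_sqrt (by linarith)
  | more n ih _ =>
    rw [integral_norm_pow_stdGaussian_recurrence]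
    have h0 : (0 : ℝ) ≤ n + Module.finrank ℝ E := by positivity
    have h1 : (((n + 2 : ℕ) : ℝ) / 2) = (n : ℝ) / 2 + 1 := by push_cast; ring
    rw [h1, Real.rpow_add_one' (by positivity) (by positivity), mul_comm]
    push_cast
    gcongr
    · refine ih.trans ?_
      gcongr
      linarith
    · linarith

theorem one_add_pow_le_exp_norm {F : Type*} [SeminormedAddCommGroup F] (N : ℕ) (x : F) :
    (1 + ‖x‖) ^ N ≤ N.factorial * Real.exp (1 + ‖x‖) := by
  have := Real.pow_div_factorial_le_exp (1 + ‖x‖) (by positivity) N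
  rwa [div_le_iff₀ (by positivity), mul_comm] at this

theorem integrable_exp_norm_stdGaussian (c : ℝ) :
    Integrable (fun x : E => Real.exp (c * ‖x‖)) (stdGaussian E) := by
  -- Fernique's theorem makes `exp (C ‖x‖²)` integrable; completing the square bounds `c ‖x‖` by `C
  -- ‖x‖²` plus a constant.
  obtain ⟨C, hC, hint⟩ := IsGaussian.exists_integrable_exp_sq (stdGaussian E)
  refine (hint.const_mul (Real.exp (c ^ 2 / (4 * C)))).mono' (by fun_prop)
    (Eventually.of_forall fun x => ?_)
  rw [Real.norm_eq_abs, Real.abs_exp, ← Real.exp_add]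
  gcongr
  have : c ^ 2 / (4 * C) + C * ‖x‖ ^ 2 - c * ‖x‖ = (c - 2 * C * ‖x‖) ^ 2 / (4 * C) := by
    field_simp; ring
  have h2 : 0 ≤ (c - 2 * C * ‖x‖) ^ 2 / (4 * C) := by positivity
  linarith

theorem integrable_one_add_norm_pow_mul_exp_stdGaussian (N : ℕ) (c : ℝ) :
    Integrable (fun x : E => (1 + ‖x‖) ^ N * Real.exp (c * ‖x‖)) (stdGaussian E) := by
  refine ((integrable_exp_norm_stdGaussian (E := E) (c + 1)).const_mul
    (N.factorial * Real.exp 1)).mono' (by fun_prop) (Eventually.of_forall fun x => ?_)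
  rw [Real.norm_of_nonneg (by positivity)]
  calc _ ≤ (N.factorial * Real.exp (1 + ‖x‖)) * Real.exp (c * ‖x‖) := by
        gcongr; exact one_add_pow_le_exp_norm N x
    _ = _ := by
        rw [add_mul, one_mul, Real.exp_add, Real.exp_add]; ring

theorem integrable_one_add_norm_pow_stdGaussian (N : ℕ) :
    Integrable (fun x : E => (1 + ‖x‖) ^ N) (stdGaussian E) := by
  simpa using integrable_one_add_norm_pow_mul_exp_stdGaussian (E := E) N 0

end GaussianMeasure

/-! ### Clarke calculus: sublinearity, attained directional derivatives, mean value inequality. -/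

section Clarke

variable {d : ℕ} {f : EuclideanSpace ℝ (Fin d) → ℝ} {R₁ R₂ : ℝ} {m : ℕ}

/-- A real `limsup` is meaningful only for bounded families; this supplies the boundedness that the
next two lemmas feed to the `limsup` API. -/
theorem LocallyLipschitz.eventually_abs_clarkeQuotient_le (hf : LocallyLipschitz f)
    (x v : EuclideanSpace ℝ (Fin d)) : ∃ K : ℝ,
    ∀ᶠ p : EuclideanSpace ℝ (Fin d) × ℝ in 𝓝 x ×ˢ 𝓝[>] (0 : ℝ),
      |(f (p.1 + p.2 • v) - f p.1) / p.2| ≤ K := by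
  obtain ⟨K, s, hs, hK⟩ := hf x
  refine ⟨K * ‖v‖, ?_⟩
  have h1 : Tendsto (fun p : EuclideanSpace ℝ (Fin d) × ℝ => p.1 + p.2 • v)
      (𝓝 x ×ˢ 𝓝[>] (0 : ℝ)) (𝓝 x) := by
    have : Tendsto (fun p : EuclideanSpace ℝ (Fin d) × ℝ => p.1 + p.2 • v)
        (𝓝 (x, 0)) (𝓝 (x + (0 : ℝ) • v)) := by
      apply Continuous.tendsto' (by fun_prop) _ _ rfl
    rw [zero_smul, add_zero, nhds_prod_eq] at this
    exact this.mono_left (Filter.prod_mono le_rfl nhdsWithin_le_nhds)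
  filter_upwards [h1.eventually hs, tendsto_fst.eventually hs,
    tendsto_snd.eventually self_mem_nhdsWithin] with p hp1 hp2 hp3
  have hp3' : 0 < p.2 := hp3
  have := hK.dist_le_mul _ hp1 _ hp2
  rw [Real.dist_eq, dist_eq_norm, add_sub_cancel_left, norm_smul, Real.norm_of_nonneg hp3'.le]
    at this
  rw [abs_div, abs_of_pos hp3', div_le_iff₀ hp3']
  linarith

theorem LocallyLipschitz.eventually_lt_of_clarkeDirDeriv_lt (hf : LocallyLipschitz f)
    {x v : EuclideanSpace ℝ (Fin d)} {b : ℝ} (hb : clarkeDirDeriv f x v < b) :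
    ∀ᶠ p : EuclideanSpace ℝ (Fin d) × ℝ in 𝓝 x ×ˢ 𝓝[>] (0 : ℝ),
      (f (p.1 + p.2 • v) - f p.1) / p.2 < b := by
  obtain ⟨K, hK⟩ := hf.eventually_abs_clarkeQuotient_le x v
  exact eventually_lt_of_limsup_lt hb
    (isBoundedUnder_of_eventually_le (hK.mono fun p hp => (abs_le.1 hp).2))

theorem LocallyLipschitz.clarkeDirDeriv_le (hf : LocallyLipschitz f)
    {x v : EuclideanSpace ℝ (Fin d)} {b : ℝ}
    (hb : ∀ᶠ p : EuclideanSpace ℝ (Fin d) × ℝ in 𝓝 x ×ˢ 𝓝[>] (0 : ℝ),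
      (f (p.1 + p.2 • v) - f p.1) / p.2 ≤ b) : clarkeDirDeriv f x v ≤ b := by
  obtain ⟨K, hK⟩ := hf.eventually_abs_clarkeQuotient_le x v
  exact limsup_le_of_le (isBoundedUnder_of_eventually_ge
    (hK.mono fun p hp => (abs_le.1 hp).1)).isCoboundedUnder_le hb

/-- The substitution `t ↦ t c` preserves the filter. Applied again with `c⁻¹`, this inequality
yields the equality below. -/
theorem LocallyLipschitz.clarkeDirDeriv_smul_le (hf : LocallyLipschitz f)
    (x v : EuclideanSpace ℝ (Fin d)) {c : ℝ} (hc : 0 < c) :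
    clarkeDirDeriv f x (c • v) ≤ c * clarkeDirDeriv f x v := by
  refine le_of_forall_gt_imp_ge_of_dense fun b hb => hf.clarkeDirDeriv_le ?_
  have h : clarkeDirDeriv f x v < b / c := by rwa [lt_div_iff₀ hc, mul_comm]
  have ht : Tendsto (fun p : EuclideanSpace ℝ (Fin d) × ℝ => (p.1, p.2 * c))
      (𝓝 x ×ˢ 𝓝[>] (0 : ℝ)) (𝓝 x ×ˢ 𝓝[>] (0 : ℝ)) := by
    refine tendsto_fst.prodMk (Tendsto.comp (g := fun t : ℝ => t * c) ?_ tendsto_snd)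
    refine tendsto_nhdsWithin_iff.2 ⟨?_, ?_⟩
    · have : Tendsto (fun t : ℝ => t * c) (𝓝 0) (𝓝 0) :=
        Continuous.tendsto' (by fun_prop) _ _ (by simp)
      exact this.mono_left nhdsWithin_le_nhds
    · filter_upwards [self_mem_nhdsWithin] with t ht
      exact mul_pos ht hc
  filter_upwards [ht.eventually (hf.eventually_lt_of_clarkeDirDeriv_lt h)] with p hp
  simp only [mul_smul, ← div_div] at hp
  exact ((div_lt_div_iff_of_pos_right hc).1 hp).le

theorem LocallyLipschitz.clarkeDirDeriv_smul (hf : LocallyLipschitz f)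
    (x v : EuclideanSpace ℝ (Fin d)) {c : ℝ} (hc : 0 < c) :
    clarkeDirDeriv f x (c • v) = c * clarkeDirDeriv f x v := by
  refine le_antisymm (hf.clarkeDirDeriv_smul_le x v hc) ?_
  have := hf.clarkeDirDeriv_smul_le x (c • v) (inv_pos.2 hc)
  rw [inv_smul_smul₀ hc.ne', inv_mul_eq_div, le_div_iff₀ hc] at this
  linarith

theorem LocallyLipschitz.clarkeDirDeriv_add_le (hf : LocallyLipschitz f)
    (x v w : EuclideanSpace ℝ (Fin d)) :
    clarkeDirDeriv f x (v + w) ≤ clarkeDirDeriv f x v + clarkeDirDeriv f x w := by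
  refine le_of_forall_gt_imp_ge_of_dense fun b hb => hf.clarkeDirDeriv_le ?_
  set ε := (b - (clarkeDirDeriv f x v + clarkeDirDeriv f x w)) / 2 with hε
  have hε0 : 0 < ε := by rw [hε]; linarith
  -- The increment along `v` is taken from the moved base point `x' + t w`, which still tends to
  -- `x`: subadditivity relies on the base point being free in Clarke's definition.
  have ht : Tendsto (fun p : EuclideanSpace ℝ (Fin d) × ℝ => (p.1 + p.2 • w, p.2))
      (𝓝 x ×ˢ 𝓝[>] (0 : ℝ)) (𝓝 x ×ˢ 𝓝[>] (0 : ℝ)) := by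
    refine Tendsto.prodMk ?_ tendsto_snd
    have : Tendsto (fun p : EuclideanSpace ℝ (Fin d) × ℝ => p.1 + p.2 • w)
        (𝓝 (x, 0)) (𝓝 (x + (0 : ℝ) • w)) := by
      apply Continuous.tendsto' (by fun_prop) _ _ rfl
    rw [zero_smul, add_zero, nhds_prod_eq] at this
    exact this.mono_left (Filter.prod_mono le_rfl nhdsWithin_le_nhds)
  filter_upwards [ht.eventually (hf.eventually_lt_of_clarkeDirDeriv_lt
      (show clarkeDirDeriv f x v < clarkeDirDeriv f x v + ε by linarith)),
    hf.eventually_lt_of_clarkeDirDeriv_lt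
      (show clarkeDirDeriv f x w < clarkeDirDeriv f x w + ε by linarith)] with p hp1 hp2
  have h : (f (p.1 + p.2 • (v + w)) - f p.1) / p.2 =
      (f (p.1 + p.2 • w + p.2 • v) - f (p.1 + p.2 • w)) / p.2 +
        (f (p.1 + p.2 • w) - f p.1) / p.2 := by
    rw [← add_div, smul_add, add_comm (p.2 • v), ← add_assoc]
    ring
  rw [h]
  linarith

/-- The Clarke directional derivative is attained by an element of the subdifferential. -/
theorem LocallyLipschitz.exists_mem_clarkeSubdiff (hf : LocallyLipschitz f)
    (x v : EuclideanSpace ℝ (Fin d)) :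
    ∃ ζ ∈ clarkeSubdiff f x, inner ℝ ζ v = clarkeDirDeriv f x v := by
  have hN0 : clarkeDirDeriv f x 0 = 0 := by
    simp [clarkeDirDeriv]
  by_cases hv : v = 0
  -- For `v = 0` any functional dominated by the Clarke derivative will do, so Hahn–Banach extends
  -- from the zero subspace.
  · obtain ⟨g, -, hg⟩ := exists_extension_of_le_sublinear (E := EuclideanSpace ℝ (Fin d))
      ⟨⊥, 0⟩ (clarkeDirDeriv f x)
      (fun c hc w => hf.clarkeDirDeriv_smul x w hc) (hf.clarkeDirDeriv_add_le x) (by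
        rintro ⟨w, hw⟩
        rw [Submodule.mem_bot] at hw
        simp [hw, hN0])
    refine ⟨(InnerProductSpace.toDual ℝ _).symm g.toContinuousLinearMap, fun w => ?_, ?_⟩
    · simpa using hg w
    · simp [hv, hN0]
  · obtain ⟨g, hg1, hg⟩ := exists_extension_of_le_sublinear
      (LinearPMap.mkSpanSingleton v (clarkeDirDeriv f x v) hv) (clarkeDirDeriv f x)
      (fun c hc w => hf.clarkeDirDeriv_smul x w hc) (hf.clarkeDirDeriv_add_le x) (by
        rintro ⟨w, hw⟩
        obtain ⟨c, rfl⟩ := Submodule.mem_span_singleton.1 hw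
        rw [LinearPMap.mkSpanSingleton'_apply, RingHom.id_apply, smul_eq_mul]
        rcases lt_trichotomy c 0 with hc | rfl | hc
        -- For negative `c`, domination on the line follows from `0 = f°(x; 0) ≤ f°(x; c v) + f°(x;
        -- -c v)`.
        · have h1 := hf.clarkeDirDeriv_add_le x (c • v) ((-c) • v)
          rw [← add_smul, add_neg_cancel, zero_smul, hN0,
            hf.clarkeDirDeriv_smul x v (neg_pos.2 hc)] at h1
          simp only
          linarith
        · simp [hN0]
        · exact (hf.clarkeDirDeriv_smul x v hc).ge)
    refine ⟨(InnerProductSpace.toDual ℝ _).symm g.toContinuousLinearMap, fun w => ?_, ?_⟩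
    · simpa using hg w
    · have := hg1 ⟨v, Submodule.mem_span_singleton_self v⟩
      have h2 := LinearPMap.mkSpanSingleton_apply ℝ ℝ (σ := RingHom.id ℝ) hv (clarkeDirDeriv f x v)
      simpa using this.trans h2

/-- A one-sided mean value inequality for the Clarke directional derivative. -/
theorem LocallyLipschitz.sub_le_of_clarkeDirDeriv_le (hf : LocallyLipschitz f)
    {x v : EuclideanSpace ℝ (Fin d)} {M : ℝ}
    (hM : ∀ t ∈ Set.Ico (0 : ℝ) 1, clarkeDirDeriv f (x + t • v) v ≤ M) :
    f (x + v) - f x ≤ M := by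
  have hcont : Continuous fun t : ℝ => f (x + t • v) := hf.continuous.comp (by fun_prop)
  have := image_le_of_liminf_slope_right_le_deriv_boundary
    (f := fun t : ℝ => f (x + t • v)) (a := 0) (b := 1) hcont.continuousOn
    (B := fun t => f x + M * t) (B' := fun _ => M) (by simp) (by fun_prop)
    (fun t _ => by
      simpa using (((hasDerivAt_id t).const_mul M).const_add (f x)).hasDerivWithinAt)
    (fun t ht r hr => by
      have h1 := hf.eventually_lt_of_clarkeDirDeriv_lt ((hM t ht).trans_lt hr)
      have h2 : Tendsto (fun z : ℝ => (x + t • v, z - t)) (𝓝[>] t)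
          (𝓝 (x + t • v) ×ˢ 𝓝[>] (0 : ℝ)) := by
        refine tendsto_const_nhds.prodMk (tendsto_nhdsWithin_iff.2 ⟨?_, ?_⟩)
        · have : Tendsto (fun z : ℝ => z - t) (𝓝 t) (𝓝 0) :=
            Continuous.tendsto' (by fun_prop) _ _ (by simp)
          exact this.mono_left nhdsWithin_le_nhds
        · filter_upwards [self_mem_nhdsWithin] with z hz
          exact sub_pos.2 (Set.mem_Ioi.1 hz)
      refine Eventually.frequently ?_
      filter_upwards [h2.eventually h1] with z hz
      rw [slope_def_field]
      convert hz using 4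
      rw [sub_smul]
      abel)
  have h1 := this (Set.right_mem_Icc.2 zero_le_one)
  simp only [one_smul, mul_one] at h1
  linarith

theorem IsSPB.clarkeDirDeriv_le (hf : IsSPB f R₁ R₂ m) (x v : EuclideanSpace ℝ (Fin d)) :
    clarkeDirDeriv f x v ≤ (R₁ * ‖x‖ ^ m + R₂) * ‖v‖ := by
  obtain ⟨ζ, hζ, h⟩ := hf.locallyLipschitz.exists_mem_clarkeSubdiff x v
  rw [← h]
  refine (real_inner_le_norm ζ v).trans ?_
  gcongr
  exact hf.bound x ζ hζ

/-- The mean value inequality on the segment, where norms are at most `‖x‖ + ‖v‖`. Being one-sided,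
it is applied also to the reversed segment, whose bound must involve the same `‖x‖` and `‖v‖`; hence
the general `z`, `w` in `key`. -/
theorem IsSPB.abs_sub_le (hf : IsSPB f R₁ R₂ m) (x v : EuclideanSpace ℝ (Fin d)) :
    |f (x + v) - f x| ≤ (2 ^ (m - 1) * R₁ * (‖x‖ ^ m + ‖v‖ ^ m) + R₂) * ‖v‖ := by
  have hR := hf.R₁_nonneg
  have key : ∀ z w : EuclideanSpace ℝ (Fin d), (∀ t ∈ Set.Ico (0 : ℝ) 1, ‖z + t • w‖ ≤ ‖x‖ + ‖v‖) →
      f (z + w) - f z ≤ (2 ^ (m - 1) * R₁ * (‖x‖ ^ m + ‖v‖ ^ m) + R₂) * ‖w‖ := by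
    intro z w h
    refine hf.locallyLipschitz.sub_le_of_clarkeDirDeriv_le fun t ht =>
      (hf.clarkeDirDeriv_le _ _).trans ?_
    refine mul_le_mul_of_nonneg_right (add_le_add_left ?_ _) (norm_nonneg _)
    calc R₁ * ‖z + t • w‖ ^ m ≤ R₁ * (‖x‖ + ‖v‖) ^ m := by gcongr; exact h t ht
      _ ≤ R₁ * (2 ^ (m - 1) * (‖x‖ ^ m + ‖v‖ ^ m)) := by
        gcongr; exact add_pow_le (norm_nonneg _) (norm_nonneg _) m
      _ = _ := by ring
  rw [abs_le]
  constructor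
  · have := key (x + v) (-v) fun t ht => by
      calc ‖x + v + t • -v‖ = ‖x + (1 - t) • v‖ := by congr 1; module
        _ ≤ ‖x‖ + ‖(1 - t) • v‖ := norm_add_le _ _
        _ ≤ ‖x‖ + 1 * ‖v‖ := by
          rw [norm_smul, Real.norm_of_nonneg (by linarith [ht.2])]
          gcongr
          linarith [ht.1]
        _ = _ := by rw [one_mul]
    rw [norm_neg, add_neg_cancel_right] at this
    linarith
  · refine key x v fun t ht => ?_
    calc ‖x + t • v‖ ≤ ‖x‖ + ‖t • v‖ := norm_add_le _ _
      _ ≤ ‖x‖ + 1 * ‖v‖ := by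
        rw [norm_smul, Real.norm_of_nonneg ht.1]
        gcongr
        exact ht.2.le
      _ = _ := by rw [one_mul]

end Clarke

/-! ### Gradient, gradient increments and descent lemma for the Gaussian smoothing. -/

section Smoothing

/-- If `g` has polynomial growth, its integrals against exponentially tilted Gaussian measures are
differentiable in the tilt at `0`. -/
theorem hasGradientAt_integral_exp_tilt {E : Type*} [NormedAddCommGroup E] [InnerProductSpace ℝ E]
    [FiniteDimensional ℝ E] [MeasurableSpace E] [BorelSpace E] {g : E → ℝ} (hg : Continuous g)
    {K : ℝ} {N : ℕ} (hK : ∀ u, |g u| ≤ K * (1 + ‖u‖) ^ N) :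
    HasGradientAt (fun h => ∫ u, Real.exp (inner ℝ u h - ‖h‖ ^ 2 / 2) * g u ∂stdGaussian E)
      (∫ u, g u • u ∂stdGaussian E) 0 := by
  have hint : ∀ n : ℕ, ∀ c : ℝ, Integrable (fun u : E => K * ((1 + ‖u‖) ^ n * Real.exp (c * ‖u‖)))
      (stdGaussian E) :=
    fun n c => (integrable_one_add_norm_pow_mul_exp_stdGaussian n c).const_mul K
  have hK0 : 0 ≤ K := by simpa using (abs_nonneg _).trans (hK 0)
  have hgu : Integrable (fun u => g u • u) (stdGaussian E) := by
    refine (hint (N + 1) 0).mono' (by fun_prop) (Eventually.of_forall fun u => ?_)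
    rw [norm_smul, Real.norm_eq_abs]
    calc |g u| * ‖u‖ ≤ (K * (1 + ‖u‖) ^ N) * (1 + ‖u‖) := by
          gcongr
          · exact hK u
          · linarith
      _ = _ := by simp; ring
  have hd := hasFDerivAt_integral_of_dominated_of_fderiv_le (μ := stdGaussian E) (𝕜 := ℝ)
    (F := fun h u => Real.exp (inner ℝ u h - ‖h‖ ^ 2 / 2) * g u)
    (F' := fun h u => (Real.exp (inner ℝ u h - ‖h‖ ^ 2 / 2) * g u) • (innerSL ℝ u - innerSL ℝ h))
    (x₀ := (0 : E)) (s := Metric.ball 0 1)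
    (bound := fun u => K * ((1 + ‖u‖) ^ (N + 1) * Real.exp (1 * ‖u‖)))
    (Metric.ball_mem_nhds _ one_pos)
    (Eventually.of_forall fun h => by fun_prop)
    (by
      refine (hint N 0).mono' (by fun_prop) (Eventually.of_forall fun u => ?_)
      simpa using hK u)
    (by fun_prop)
    (Eventually.of_forall fun u h hh => by
      have hh1 : ‖h‖ ≤ 1 := by simpa using (Metric.mem_ball.1 hh).le
      rw [norm_smul, norm_mul, Real.norm_eq_abs, Real.abs_exp, Real.norm_eq_abs]
      -- On the unit ball the tilt is at most `exp ‖u‖`, which is Gaussian integrable against any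
      -- polynomial; this gives a domination independent of `h`.
      have h1 : inner ℝ u h - ‖h‖ ^ 2 / 2 ≤ 1 * ‖u‖ := by
        have := real_inner_le_norm u h
        nlinarith [norm_nonneg u, norm_nonneg h]
      have h2 : ‖innerSL ℝ u - innerSL ℝ h‖ ≤ 1 + ‖u‖ := by
        calc _ ≤ ‖innerSL ℝ u‖ + ‖innerSL ℝ h‖ := norm_sub_le _ _
          _ ≤ 1 + ‖u‖ := by rw [innerSL_apply_norm, innerSL_apply_norm]; linarith
      calc _ ≤ (Real.exp (1 * ‖u‖) * (K * (1 + ‖u‖) ^ N)) * (1 + ‖u‖) := by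
            gcongr
            exact hK u
        _ = _ := by ring)
    (hint (N + 1) 1)
    (Eventually.of_forall fun u h _ => by
      have h1 : HasFDerivAt (fun h : E => inner ℝ u h - ‖h‖ ^ 2 / 2)
          (innerSL ℝ u - innerSL ℝ h) h := by
        have ha : HasFDerivAt (fun h : E => inner ℝ u h) (innerSL ℝ u) h :=
          (innerSL ℝ u).hasFDerivAt
        have hb := ((hasStrictFDerivAt_norm_sq h).hasFDerivAt.mul_const (1 / 2 : ℝ))
        refine ((ha.sub hb).congr_fderiv ?_).congr_of_eventuallyEq (Eventually.of_forall fun y => ?_)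
        · ext y; simp
        · simp [div_eq_mul_inv]
      refine (h1.exp.mul_const (g u)).congr_fderiv ?_
      rw [smul_smul, mul_comm])
  rw [hasGradientAt_iff_hasFDerivAt]
  refine hd.congr_fderiv (ContinuousLinearMap.ext fun v => ?_)
  have hF' : Integrable (fun u : E => (Real.exp (inner ℝ u 0 - ‖(0 : E)‖ ^ 2 / 2) * g u) •
      (innerSL ℝ u - innerSL ℝ 0)) (stdGaussian E) := by
    refine (hint (N + 1) 0).mono' (by fun_prop) (Eventually.of_forall fun u => ?_)
    rw [norm_smul]
    simp only [inner_zero_right, norm_zero, map_zero, sub_zero, innerSL_apply_norm]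
    calc _ ≤ (K * (1 + ‖u‖) ^ N) * (1 + ‖u‖) := by
          gcongr
          · simpa using hK u
          · linarith
      _ = _ := by simp; ring
  rw [ContinuousLinearMap.integral_apply hF', InnerProductSpace.toDual_apply_apply, real_inner_comm,
    ← integral_inner hgu]
  refine integral_congr_ae (Eventually.of_forall fun u => ?_)
  simp [real_inner_smul_right, real_inner_comm]

variable {d : ℕ} {f : EuclideanSpace ℝ (Fin d) → ℝ} {R₁ R₂ : ℝ} {m : ℕ} {σ : ℝ}

theorem IsSPB.exists_abs_le (hf : IsSPB f R₁ R₂ m) :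
    ∃ K, 0 ≤ K ∧ ∀ x, |f x| ≤ K * (1 + ‖x‖) ^ (m + 1) := by
  have hR := hf.R₁_nonneg
  have hR2 := hf.R₂_pos.le
  refine ⟨|f 0| + (2 ^ (m - 1) * R₁ * (1 + 1) + R₂), by positivity, fun x => ?_⟩
  have h1 := hf.abs_sub_le 0 x
  rw [zero_add, norm_zero] at h1
  have h2 : (1 : ℝ) ≤ (1 + ‖x‖) ^ m := one_le_pow₀ (by linarith [norm_nonneg x])
  have h3 : (0 : ℝ) ^ m ≤ (1 + ‖x‖) ^ m := (pow_le_one₀ le_rfl zero_le_one).trans h2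
  have h4 : ‖x‖ ^ m ≤ (1 + ‖x‖) ^ m := by gcongr; linarith
  have h5 : ‖x‖ ≤ 1 + ‖x‖ := by linarith
  calc |f x| = |f 0 + (f x - f 0)| := by ring_nf
    _ ≤ |f 0| + |f x - f 0| := abs_add_le _ _
    _ ≤ |f 0| * 1 + (2 ^ (m - 1) * R₁ * ((1 + ‖x‖) ^ m + (1 + ‖x‖) ^ m) + R₂ * (1 + ‖x‖) ^ m) *
        (1 + ‖x‖) := by
      rw [mul_one]
      refine add_le_add le_rfl (h1.trans ?_)
      gcongr
      exact le_mul_of_one_le_right hR2 h2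
    _ ≤ |f 0| * (1 + ‖x‖) ^ (m + 1) + (2 ^ (m - 1) * R₁ * ((1 + ‖x‖) ^ m + (1 + ‖x‖) ^ m) +
        R₂ * (1 + ‖x‖) ^ m) * (1 + ‖x‖) := by
      gcongr
      exact one_le_pow₀ (by linarith [norm_nonneg x])
    _ = _ := by ring

theorem one_add_norm_add_smul_le {E : Type*} [SeminormedAddCommGroup E] [NormedSpace ℝ E]
    (hσ : 0 ≤ σ) (x u : E) : 1 + ‖x + σ • u‖ ≤ (1 + σ) * (1 + ‖x‖) * (1 + ‖u‖) := by
  have := norm_add_le x (σ • u)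
  rw [norm_smul, Real.norm_of_nonneg hσ] at this
  calc 1 + ‖x + σ • u‖ ≤ 1 + ‖x‖ + σ * ‖u‖ := by linarith
    _ ≤ 1 + ‖x‖ + σ * ‖u‖ + (σ + ‖u‖ + σ * ‖x‖ + ‖x‖ * ‖u‖ + σ * ‖x‖ * ‖u‖) :=
        le_add_of_nonneg_right (by positivity)
    _ = _ := by ring

theorem IsSPB.exists_abs_add_smul_le (hf : IsSPB f R₁ R₂ m) (hσ : 0 ≤ σ) :
    ∃ K, 0 ≤ K ∧ ∀ x u, |f (x + σ • u)| ≤ K * (1 + ‖x‖) ^ (m + 1) * (1 + ‖u‖) ^ (m + 1) := by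
  obtain ⟨K, hK0, hK⟩ := hf.exists_abs_le
  refine ⟨K * (1 + σ) ^ (m + 1), by positivity, fun x u => (hK _).trans ?_⟩
  calc K * (1 + ‖x + σ • u‖) ^ (m + 1) ≤ K * ((1 + σ) * (1 + ‖x‖) * (1 + ‖u‖)) ^ (m + 1) := by
        gcongr; exact one_add_norm_add_smul_le hσ x u
    _ = _ := by rw [mul_pow, mul_pow]; ring

theorem IsSPB.integrable_add_smul (hf : IsSPB f R₁ R₂ m) (hσ : 0 ≤ σ)
    (x : EuclideanSpace ℝ (Fin d)) :
    Integrable (fun u => f (x + σ • u)) (stdGaussian (EuclideanSpace ℝ (Fin d))) := by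
  obtain ⟨K, hK0, hK⟩ := hf.exists_abs_add_smul_le hσ
  have hc := hf.locallyLipschitz.continuous
  exact ((integrable_one_add_norm_pow_stdGaussian (m + 1)).const_mul _).mono' (by fun_prop)
    (Eventually.of_forall fun u => hK x u)

theorem IsSPB.integrable_add_smul_smul (hf : IsSPB f R₁ R₂ m) (hσ : 0 ≤ σ)
    (x : EuclideanSpace ℝ (Fin d)) :
    Integrable (fun u => f (x + σ • u) • u) (stdGaussian (EuclideanSpace ℝ (Fin d))) := by
  obtain ⟨K, hK0, hK⟩ := hf.exists_abs_add_smul_le hσ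
  have hc := hf.locallyLipschitz.continuous
  refine ((integrable_one_add_norm_pow_stdGaussian (m + 2)).const_mul
    (K * (1 + ‖x‖) ^ (m + 1))).mono' (by fun_prop) (Eventually.of_forall fun u => ?_)
  rw [norm_smul, Real.norm_eq_abs]
  calc |f (x + σ • u)| * ‖u‖ ≤ (K * (1 + ‖x‖) ^ (m + 1) * (1 + ‖u‖) ^ (m + 1)) * (1 + ‖u‖) := by
        gcongr
        · exact hK x u
        · linarith
    _ = _ := by ring

/-- The gradient of the Gaussian smoothing, as a Gaussian integral. -/
noncomputable def smoothingGradient (f : EuclideanSpace ℝ (Fin d) → ℝ) (σ : ℝ)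
    (x : EuclideanSpace ℝ (Fin d)) : EuclideanSpace ℝ (Fin d) :=
  σ⁻¹ • ∫ u, f (x + σ • u) • u ∂(stdGaussian (EuclideanSpace ℝ (Fin d)))

theorem IsSPB.hasGradientAt_gaussianSmoothing (hf : IsSPB f R₁ R₂ m) (hσ : 0 < σ)
    (x : EuclideanSpace ℝ (Fin d)) :
    HasGradientAt (gaussianSmoothing f σ) (smoothingGradient f σ x) x := by
  obtain ⟨K, hK0, hK⟩ := hf.exists_abs_add_smul_le hσ.le
  have hc := hf.locallyLipschitz.continuous
  have h := hasGradientAt_integral_exp_tilt (g := fun u => f (x + σ • u)) (by fun_prop) (hK x)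
  -- Cameron–Martin with shift `(y - x) / σ` puts all dependence on `y` into the exponential weight,
  -- so no derivative of `f` is needed.
  have heq : gaussianSmoothing f σ = (fun h => ∫ u, Real.exp (inner ℝ u h - ‖h‖ ^ 2 / 2) *
      f (x + σ • u) ∂stdGaussian (EuclideanSpace ℝ (Fin d))) ∘ fun y => σ⁻¹ • (y - x) := by
    ext y
    have := integral_stdGaussian_add (fun u => f (x + σ • u)) (σ⁻¹ • (y - x))
    simp only [smul_eq_mul] at this
    rw [Function.comp_apply, ← this, gaussianSmoothing]
    refine integral_congr_ae (Eventually.of_forall fun u => ?_)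
    simp only
    congr 1
    rw [smul_add, smul_inv_smul₀ hσ.ne']
    abel
  have hlin : HasFDerivAt (fun y : EuclideanSpace ℝ (Fin d) => σ⁻¹ • (y - x))
      (σ⁻¹ • ContinuousLinearMap.id ℝ (EuclideanSpace ℝ (Fin d))) x :=
    ((hasFDerivAt_id x).sub_const x).const_smul σ⁻¹
  rw [hasGradientAt_iff_hasFDerivAt] at h ⊢
  rw [heq]
  have h' := HasFDerivAt.comp (x := x) (f := fun y => σ⁻¹ • (y - x)) (by simpa using h) hlin
  refine h'.congr_fderiv (ContinuousLinearMap.ext fun v => ?_)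
  simp [smoothingGradient]

theorem IsSPB.gradient_gaussianSmoothing (hf : IsSPB f R₁ R₂ m) (hσ : 0 < σ)
    (x : EuclideanSpace ℝ (Fin d)) :
    gradient (gaussianSmoothing f σ) x = smoothingGradient f σ x :=
  (hf.hasGradientAt_gaussianSmoothing hσ x).gradient

theorem integral_add_mul_norm_pow_mul_norm_le {a b : ℝ} (hb : 0 ≤ b) (ha : 0 ≤ a) (m : ℕ) :
    Integrable (fun u => (a + b * ‖u‖ ^ m) * ‖u‖) (stdGaussian (EuclideanSpace ℝ (Fin d))) ∧
    ∫ u, (a + b * ‖u‖ ^ m) * ‖u‖ ∂stdGaussian (EuclideanSpace ℝ (Fin d)) ≤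
      a * √(d : ℝ) + b * ((m : ℝ) + 1 + d) ^ (((m : ℝ) + 1) / 2) := by
  have h : ∀ u : EuclideanSpace ℝ (Fin d),
      (a + b * ‖u‖ ^ m) * ‖u‖ = a * ‖u‖ + b * ‖u‖ ^ (m + 1) := fun u => by ring
  simp_rw [h]
  have h1 : Integrable (fun u : EuclideanSpace ℝ (Fin d) => a * ‖u‖) (stdGaussian _) := by
    simpa using (integrable_norm_pow_stdGaussian (E := EuclideanSpace ℝ (Fin d)) 1).const_mul a
  have h2 : Integrable (fun u : EuclideanSpace ℝ (Fin d) => b * ‖u‖ ^ (m + 1)) (stdGaussian _) :=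
    (integrable_norm_pow_stdGaussian (m + 1)).const_mul b
  refine ⟨h1.add h2, ?_⟩
  rw [integral_add h1 h2, integral_const_mul, integral_const_mul]
  have h3 := integral_norm_pow_stdGaussian_le (E := EuclideanSpace ℝ (Fin d)) (m + 1)
  have h4 := integral_norm_stdGaussian_le (E := EuclideanSpace ℝ (Fin d))
  simp only [finrank_euclideanSpace_fin, Nat.cast_add, Nat.cast_one] at h3 h4
  gcongr

theorem norm_add_smul_pow_le (hσ : 0 ≤ σ) (x u : EuclideanSpace ℝ (Fin d)) (m : ℕ) :
    ‖x + σ • u‖ ^ m ≤ 2 ^ (m - 1) * (‖x‖ ^ m + σ ^ m * ‖u‖ ^ m) := by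
  calc ‖x + σ • u‖ ^ m ≤ (‖x‖ + σ * ‖u‖) ^ m := by
        gcongr
        refine (norm_add_le _ _).trans ?_
        rw [norm_smul, Real.norm_of_nonneg hσ]
    _ ≤ 2 ^ (m - 1) * (‖x‖ ^ m + (σ * ‖u‖) ^ m) :=
        add_pow_le (norm_nonneg _) (by positivity) m
    _ = _ := by rw [mul_pow]

/-- The constants of the statement use integer exponents, the estimates truncated natural ones; they
agree because `1 ≤ m`. -/
theorem two_zpow_natCast_sub_one {m : ℕ} (hm : 1 ≤ m) :
    (2 : ℝ) ^ ((m : ℤ) - 1) = 2 ^ (m - 1) := by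
  rw [← zpow_natCast, Nat.cast_sub hm, Nat.cast_one]

/-- The integrands differ by an increment of `f` at `x + σ u`, bounded by `IsSPB.abs_sub_le`.
Splitting `‖x + σ u‖ ^ m` costs a second factor `2 ^ (m - 1)`, which is why `constA` and `constB`
carry it squared and `constC` only once. -/
theorem IsSPB.norm_smoothingGradient_sub_le (hf : IsSPB f R₁ R₂ m) (hm : 1 ≤ m) (hσ : 0 < σ)
    (x v : EuclideanSpace ℝ (Fin d)) :
    ‖smoothingGradient f σ (x + v) - smoothingGradient f σ x‖ ≤
      (constA d m R₁ R₂ σ + constB d m R₁ σ * ‖x‖ ^ m + constC d m R₁ σ * ‖v‖ ^ m) * ‖v‖ := by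
  have hR := hf.R₁_nonneg
  have hR2 := hf.R₂_pos.le
  set c : ℝ := 2 ^ (m - 1) with hc
  have hc0 : 0 ≤ c := by positivity
  obtain ⟨hI, hle⟩ := integral_add_mul_norm_pow_mul_norm_le (d := d)
    (a := (c * R₁ * (c * ‖x‖ ^ m + ‖v‖ ^ m) + R₂) * ‖v‖) (b := c * R₁ * c * σ ^ m * ‖v‖)
    (by positivity) (by positivity) m
  rw [smoothingGradient, smoothingGradient, ← smul_sub, ← integral_sub
    (hf.integrable_add_smul_smul hσ.le _) (hf.integrable_add_smul_smul hσ.le _), norm_smul,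
    Real.norm_of_nonneg (by positivity)]
  have h1 : ‖∫ u, (f (x + v + σ • u) • u - f (x + σ • u) • u)
      ∂stdGaussian (EuclideanSpace ℝ (Fin d))‖ ≤
      ∫ u, ((c * R₁ * (c * ‖x‖ ^ m + ‖v‖ ^ m) + R₂) * ‖v‖ + c * R₁ * c * σ ^ m * ‖v‖ * ‖u‖ ^ m) *
        ‖u‖ ∂stdGaussian (EuclideanSpace ℝ (Fin d)) := by
    refine norm_integral_le_of_norm_le hI (Eventually.of_forall fun u => ?_)
    rw [← sub_smul, norm_smul, Real.norm_eq_abs, add_right_comm]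
    gcongr
    refine (hf.abs_sub_le _ v).trans ?_
    calc (c * R₁ * (‖x + σ • u‖ ^ m + ‖v‖ ^ m) + R₂) * ‖v‖
        ≤ (c * R₁ * (c * (‖x‖ ^ m + σ ^ m * ‖u‖ ^ m) + ‖v‖ ^ m) + R₂) * ‖v‖ := by
          gcongr
          exact norm_add_smul_pow_le hσ.le x u m
      _ = _ := by ring
  refine (mul_le_mul_of_nonneg_left (h1.trans hle) (by positivity)).trans (le_of_eq ?_)
  have hσm : σ ^ ((m : ℤ) - 1) = σ⁻¹ * σ ^ m := by
    rw [zpow_sub_one₀ hσ.ne', zpow_natCast, mul_comm]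
  have h2m : (2 : ℝ) ^ (2 * (m : ℤ) - 2) = c * c := by
    rw [hc, ← two_zpow_natCast_sub_one hm, ← zpow_add₀ two_ne_zero]
    congr 1
    ring
  rw [constA, constB, constC, hσm, h2m, two_zpow_natCast_sub_one hm, ← hc]
  ring

theorem IsSPB.abs_gaussianSmoothing_sub_le (hf : IsSPB f R₁ R₂ m) (hm : 1 ≤ m) (hσ : 0 < σ)
    (x : EuclideanSpace ℝ (Fin d)) :
    |gaussianSmoothing f σ x - f x| ≤ constM m R₁ R₂ σ x * σ := by
  have hR := hf.R₁_nonneg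
  have hR2 := hf.R₂_pos.le
  set c : ℝ := 2 ^ (m - 1) with hc
  have hc0 : 0 ≤ c := by positivity
  obtain ⟨hI, hle⟩ := integral_add_mul_norm_pow_mul_norm_le (d := d)
    (a := (c * R₁ * ‖x‖ ^ m + R₂) * σ) (b := c * R₁ * σ ^ m * σ)
    (by positivity) (by positivity) m
  have h0 : gaussianSmoothing f σ x - f x =
      ∫ u, (f (x + σ • u) - f x) ∂stdGaussian (EuclideanSpace ℝ (Fin d)) := by
    rw [integral_sub (hf.integrable_add_smul hσ.le x) (integrable_const _)]
    simp [gaussianSmoothing]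
  rw [h0, ← Real.norm_eq_abs]
  refine (norm_integral_le_of_norm_le hI (Eventually.of_forall fun u => ?_)).trans
    (hle.trans (le_of_eq ?_))
  · refine (hf.abs_sub_le x _).trans (le_of_eq ?_)
    rw [norm_smul, Real.norm_of_nonneg hσ.le, mul_pow]
    ring
  · rw [constM, two_zpow_natCast_sub_one hm, ← hc]
    ring

theorem constA_nonneg (hR : 0 ≤ R₁) (hR2 : 0 ≤ R₂) (hσ : 0 ≤ σ) : 0 ≤ constA d m R₁ R₂ σ := by
  unfold constA; positivity

theorem constB_nonneg (hR : 0 ≤ R₁) (hσ : 0 ≤ σ) : 0 ≤ constB d m R₁ σ := by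
  unfold constB; positivity

theorem constC_nonneg (hR : 0 ≤ R₁) (hσ : 0 ≤ σ) : 0 ≤ constC d m R₁ σ := by
  unfold constC; positivity

theorem IsSPB.continuous_gaussianSmoothing (hf : IsSPB f R₁ R₂ m) (hσ : 0 < σ) :
    Continuous (gaussianSmoothing f σ) :=
  continuous_iff_continuousAt.2 fun x =>
    (hf.hasGradientAt_gaussianSmoothing hσ x).differentiableAt.continuousAt

theorem IsSPB.continuous_smoothingGradient (hf : IsSPB f R₁ R₂ m) (hm : 1 ≤ m) (hσ : 0 < σ) :
    Continuous (smoothingGradient f σ) := by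
  refine continuous_iff_continuousAt.2 fun x => ?_
  rw [ContinuousAt, tendsto_iff_norm_sub_tendsto_zero]
  have hlim : Tendsto (fun y => (constA d m R₁ R₂ σ + constB d m R₁ σ * ‖x‖ ^ m +
      constC d m R₁ σ * ‖y - x‖ ^ m) * ‖y - x‖) (𝓝 x) (𝓝 0) :=
    Continuous.tendsto' (by fun_prop) _ _ (by simp)
  refine squeeze_zero (fun _ => norm_nonneg _) (fun y => ?_) hlim
  simpa using hf.norm_smoothingGradient_sub_le hm hσ x (y - x)

/-- The descent lemma for the Gaussian smoothing. -/
theorem IsSPB.gaussianSmoothing_add_le (hf : IsSPB f R₁ R₂ m) (hm : 1 ≤ m) (hσ : 0 < σ)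
    (x v : EuclideanSpace ℝ (Fin d)) :
    gaussianSmoothing f σ (x + v) ≤ gaussianSmoothing f σ x +
      inner ℝ (smoothingGradient f σ x) v +
      (constA d m R₁ R₂ σ + constB d m R₁ σ * ‖x‖ ^ m) / 2 * ‖v‖ ^ 2 +
      constC d m R₁ σ / ((m : ℝ) + 2) * ‖v‖ ^ (m + 2) := by
  set L := constA d m R₁ R₂ σ + constB d m R₁ σ * ‖x‖ ^ m with hL
  set C := constC d m R₁ σ with hC
  -- The smoothing on the segment minus the claimed upper bound. Its derivative is nonpositive by
  -- the gradient estimate; `1 / 2` and `1 / (m + 2)` arise from integrating `t` and `t ^ (m + 1)`.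
  let g : ℝ → ℝ := fun t => gaussianSmoothing f σ (x + t • v) -
    t * inner ℝ (smoothingGradient f σ x) v - L / 2 * ‖v‖ ^ 2 * t ^ 2 -
      C / ((m : ℝ) + 2) * ‖v‖ ^ (m + 2) * t ^ (m + 2)
  have hderiv : ∀ t : ℝ, HasDerivAt g (inner ℝ (smoothingGradient f σ (x + t • v)) v -
      inner ℝ (smoothingGradient f σ x) v - L * ‖v‖ ^ 2 * t -
        C * ‖v‖ ^ (m + 2) * t ^ (m + 1)) t := by
    intro t
    have h1 : HasDerivAt (fun t : ℝ => gaussianSmoothing f σ (x + t • v))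
        (inner ℝ (smoothingGradient f σ (x + t • v)) v) t := by
      have hg := (hf.hasGradientAt_gaussianSmoothing hσ (x + t • v)).hasFDerivAt
      have hl : HasDerivAt (fun t : ℝ => x + t • v) v t := by
        simpa using ((hasDerivAt_id t).smul_const v).const_add x
      have h := hg.comp_hasDerivAt t hl
      rwa [InnerProductSpace.toDual_apply_apply] at h
    have h2 := (((h1.sub ((hasDerivAt_id t).mul_const
      (inner ℝ (smoothingGradient f σ x) v))).sub
      ((hasDerivAt_pow 2 t).const_mul (L / 2 * ‖v‖ ^ 2))).sub
      ((hasDerivAt_pow (m + 2) t).const_mul (C / ((m : ℝ) + 2) * ‖v‖ ^ (m + 2))))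
    refine h2.congr_deriv ?_
    have : (m : ℝ) + 2 ≠ 0 := by positivity
    simp only [Nat.add_succ_sub_one, Nat.cast_add, Nat.cast_ofNat]
    field_simp
    ring
  have hanti : AntitoneOn g (Set.Icc 0 1) := by
    refine antitoneOn_of_deriv_nonpos (convex_Icc 0 1)
      (fun t _ => (hderiv t).continuousAt.continuousWithinAt)
      (fun t _ => (hderiv t).differentiableAt.differentiableWithinAt) fun t ht => ?_
    rw [interior_Icc] at ht
    rw [(hderiv t).deriv, ← inner_sub_left]
    have h1 := real_inner_le_norm (smoothingGradient f σ (x + t • v) - smoothingGradient f σ x) v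
    have h2 := hf.norm_smoothingGradient_sub_le hm hσ x (t • v)
    rw [norm_smul, Real.norm_of_nonneg ht.1.le, mul_pow] at h2
    have h3 := mul_le_mul_of_nonneg_right h2 (norm_nonneg v)
    have h4 : (constA d m R₁ R₂ σ + constB d m R₁ σ * ‖x‖ ^ m +
        constC d m R₁ σ * (t ^ m * ‖v‖ ^ m)) * (t * ‖v‖) * ‖v‖ =
        L * ‖v‖ ^ 2 * t + C * ‖v‖ ^ (m + 2) * t ^ (m + 1) := by
      rw [← hL, ← hC]; ring
    linarith
  have := hanti (Set.left_mem_Icc.2 zero_le_one) (Set.right_mem_Icc.2 zero_le_one) zero_le_one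
  simp only [g, one_smul, zero_smul, add_zero, one_mul, zero_mul, one_pow, mul_one, sub_zero,
    ne_eq, OfNat.ofNat_ne_zero, not_false_eq_true, zero_pow, mul_zero, Nat.add_eq_zero_iff,
    and_false] at this
  linarith

theorem IsSPB.le_gaussianSmoothing (hf : IsSPB f R₁ R₂ m) (hσ : 0 ≤ σ) {b : ℝ} (hb : ∀ x, b ≤ f x)
    (x : EuclideanSpace ℝ (Fin d)) : b ≤ gaussianSmoothing f σ x := by
  have := integral_mono (integrable_const b) (hf.integrable_add_smul hσ x) fun u => hb _
  simpa [gaussianSmoothing] using this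

theorem IsSPB.exists_abs_gaussianSmoothing_le (hf : IsSPB f R₁ R₂ m) (hσ : 0 ≤ σ) :
    ∃ K, 0 ≤ K ∧ ∀ x, |gaussianSmoothing f σ x| ≤ K * (1 + ‖x‖) ^ (m + 1) := by
  obtain ⟨K, hK0, hK⟩ := hf.exists_abs_add_smul_le hσ
  have hI := integrable_one_add_norm_pow_stdGaussian (E := EuclideanSpace ℝ (Fin d)) (m + 1)
  refine ⟨K * ∫ u, (1 + ‖u‖) ^ (m + 1) ∂stdGaussian (EuclideanSpace ℝ (Fin d)),
    mul_nonneg hK0 (integral_nonneg fun u => by positivity), fun x => ?_⟩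
  refine (norm_integral_le_of_norm_le (f := fun u => f (x + σ • u))
    (hI.const_mul (K * (1 + ‖x‖) ^ (m + 1))) (Eventually.of_forall fun u => hK x u)).trans (le_of_eq ?_)
  rw [integral_const_mul]
  ring

theorem IsSPB.exists_norm_smoothingGradient_le (hf : IsSPB f R₁ R₂ m) (hm : 1 ≤ m) (hσ : 0 < σ) :
    ∃ K, 0 ≤ K ∧ ∀ x, ‖smoothingGradient f σ x‖ ≤ K * (1 + ‖x‖) ^ (m + 1) := by
  have hA := constA_nonneg (d := d) (m := m) hf.R₁_nonneg hf.R₂_pos.le hσ.le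
  have hC := constC_nonneg (d := d) (m := m) hf.R₁_nonneg hσ.le
  refine ⟨‖smoothingGradient f σ 0‖ + (constA d m R₁ R₂ σ + constC d m R₁ σ), by positivity,
    fun x => ?_⟩
  have h := hf.norm_smoothingGradient_sub_le hm hσ 0 x
  rw [zero_add, norm_zero, zero_pow (by omega), mul_zero, add_zero] at h
  have h2 : (1 : ℝ) ≤ (1 + ‖x‖) ^ m := one_le_pow₀ (by linarith [norm_nonneg x])
  have h3 : (1 : ℝ) ≤ (1 + ‖x‖) ^ (m + 1) := one_le_pow₀ (by linarith [norm_nonneg x])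
  calc ‖smoothingGradient f σ x‖
      = ‖smoothingGradient f σ 0 + (smoothingGradient f σ x - smoothingGradient f σ 0)‖ := by
        rw [add_sub_cancel]
    _ ≤ ‖smoothingGradient f σ 0‖ + ‖smoothingGradient f σ x - smoothingGradient f σ 0‖ :=
        norm_add_le _ _
    _ ≤ ‖smoothingGradient f σ 0‖ * (1 + ‖x‖) ^ (m + 1) + (constA d m R₁ R₂ σ * (1 + ‖x‖) ^ m +
        constC d m R₁ σ * (1 + ‖x‖) ^ m) * (1 + ‖x‖) := by
        refine add_le_add (le_mul_of_one_le_right (norm_nonneg _) h3) (h.trans ?_)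
        gcongr
        · exact le_mul_of_one_le_right hA h2
        · linarith
        · linarith
    _ = _ := by ring

end Smoothing

/-! ### Moments of the search direction and expected decrease in one step. -/

section OneStep

variable {d : ℕ} {f : EuclideanSpace ℝ (Fin d) → ℝ} {R₁ R₂ : ℝ} {m : ℕ} {σ : ℝ}

/-- The zeroth-order search direction at `x` for a realization `u` of the Gaussian vector. -/
noncomputable def zoDirection (f : EuclideanSpace ℝ (Fin d) → ℝ) (σ : ℝ)
    (x u : EuclideanSpace ℝ (Fin d)) : EuclideanSpace ℝ (Fin d) :=
  ((f (x + σ • u) - f x) / σ) • u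

/-- One step of the zeroth-order algorithm with step size `t`. -/
noncomputable def zoStep (f : EuclideanSpace ℝ (Fin d) → ℝ) (m : ℕ) (σ t : ℝ)
    (x u : EuclideanSpace ℝ (Fin d)) : EuclideanSpace ℝ (Fin d) :=
  x - (t / (‖x‖ ^ (2 * m) + 1)) • zoDirection f σ x u

theorem IsSPB.continuous_uncurry_zoStep (hf : IsSPB f R₁ R₂ m) (t : ℝ) :
    Continuous fun p : EuclideanSpace ℝ (Fin d) × EuclideanSpace ℝ (Fin d) =>
      zoStep f m σ t p.1 p.2 := by
  have hc := hf.locallyLipschitz.continuous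
  unfold zoStep zoDirection
  have h : ∀ p : EuclideanSpace ℝ (Fin d) × EuclideanSpace ℝ (Fin d),
      ‖p.1‖ ^ (2 * m) + 1 ≠ 0 := fun p => by positivity
  fun_prop (disch := assumption)

theorem IsSPB.continuous_zoDirection (hf : IsSPB f R₁ R₂ m) (x : EuclideanSpace ℝ (Fin d)) :
    Continuous (zoDirection f σ x) := by
  have hc := hf.locallyLipschitz.continuous
  unfold zoDirection
  fun_prop

theorem IsSPB.norm_zoDirection_le (hf : IsSPB f R₁ R₂ m) (hσ : 0 < σ)
    (x u : EuclideanSpace ℝ (Fin d)) :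
    ‖zoDirection f σ x u‖ ≤
      (2 ^ (m - 1) * R₁ * (‖x‖ ^ m + σ ^ m * ‖u‖ ^ m) + R₂) * ‖u‖ ^ 2 := by
  have h := hf.abs_sub_le x (σ • u)
  rw [norm_smul, Real.norm_of_nonneg hσ.le, mul_pow] at h
  rw [zoDirection, norm_smul, Real.norm_eq_abs, abs_div, abs_of_pos hσ]
  calc |f (x + σ • u) - f x| / σ * ‖u‖
      ≤ (2 ^ (m - 1) * R₁ * (‖x‖ ^ m + σ ^ m * ‖u‖ ^ m) + R₂) * (σ * ‖u‖) / σ * ‖u‖ := by gcongr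
    _ = _ := by field_simp

theorem add_add_pow_le {a b c : ℝ} (ha : 0 ≤ a) (hb : 0 ≤ b) (hc : 0 ≤ c) {p : ℕ} (hp : 1 ≤ p) :
    (a + b + c) ^ p ≤ 3 ^ (p - 1) * (a ^ p + b ^ p + c ^ p) := by
  obtain ⟨n, rfl⟩ := Nat.exists_eq_add_of_le' hp
  have := pow_sum_div_card_le_sum_pow (s := Finset.univ) (f := ![a, b, c]) (n := n)
    (by intro i _; fin_cases i <;> simpa)
  simp only [Fin.sum_univ_three, Finset.card_univ, Fintype.card_fin] at this
  rw [div_le_iff₀ (by positivity)] at this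
  simpa [mul_comm] using this

/-- The norm bound splits into the terms `‖x‖ ^ m ‖u‖²`, `‖u‖²` and `‖u‖ ^ (m + 2)`. The power mean
inequality gives `3 ^ (p - 1)`, and the maximum in `constH` dominates both the coefficient of `‖x‖ ^
(m * p)` and the constant term. -/
theorem IsSPB.integral_norm_zoDirection_pow_le (hf : IsSPB f R₁ R₂ m) (hm : 1 ≤ m) (hσ : 0 < σ)
    {p : ℕ} (hp : 1 ≤ p) (x : EuclideanSpace ℝ (Fin d)) :
    Integrable (fun u => ‖zoDirection f σ x u‖ ^ p) (stdGaussian (EuclideanSpace ℝ (Fin d))) ∧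
    ∫ u, ‖zoDirection f σ x u‖ ^ p ∂stdGaussian (EuclideanSpace ℝ (Fin d)) ≤
      constH d m R₁ R₂ σ p * (‖x‖ ^ (m * p) + 1) := by
  have hR := hf.R₁_nonneg
  have hR2 := hf.R₂_pos.le
  have hcont := hf.continuous_zoDirection (σ := σ) x
  set c : ℝ := 2 ^ (m - 1) with hc
  have hc0 : 0 ≤ c := by positivity
  have hcp : (2 : ℝ) ^ (((m : ℤ) - 1) * p) = c ^ p := by
    rw [zpow_mul, two_zpow_natCast_sub_one hm, zpow_natCast]
  have hpt : ∀ u, ‖zoDirection f σ x u‖ ^ p ≤ 3 ^ (p - 1) *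
      ((c ^ p * R₁ ^ p * ‖x‖ ^ (m * p) + R₂ ^ p) * ‖u‖ ^ (2 * p) +
        c ^ p * R₁ ^ p * σ ^ (m * p) * ‖u‖ ^ ((m + 2) * p)) := by
    intro u
    calc ‖zoDirection f σ x u‖ ^ p
        ≤ ((c * R₁ * (‖x‖ ^ m + σ ^ m * ‖u‖ ^ m) + R₂) * ‖u‖ ^ 2) ^ p := by
          gcongr; exact hf.norm_zoDirection_le hσ x u
      _ = (c * R₁ * ‖x‖ ^ m * ‖u‖ ^ 2 + R₂ * ‖u‖ ^ 2 + c * R₁ * σ ^ m * ‖u‖ ^ (m + 2)) ^ p := by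
          ring
      _ ≤ 3 ^ (p - 1) * ((c * R₁ * ‖x‖ ^ m * ‖u‖ ^ 2) ^ p + (R₂ * ‖u‖ ^ 2) ^ p +
          (c * R₁ * σ ^ m * ‖u‖ ^ (m + 2)) ^ p) :=
          add_add_pow_le (by positivity) (by positivity) (by positivity) hp
      _ = _ := by simp only [mul_pow, ← pow_mul]; ring
  have hi1 := (integrable_norm_pow_stdGaussian (E := EuclideanSpace ℝ (Fin d)) (2 * p)).const_mul
    (c ^ p * R₁ ^ p * ‖x‖ ^ (m * p) + R₂ ^ p)
  have hi2 := (integrable_norm_pow_stdGaussian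
    (E := EuclideanSpace ℝ (Fin d)) ((m + 2) * p)).const_mul (c ^ p * R₁ ^ p * σ ^ (m * p))
  have hint := (hi1.add hi2).const_mul (3 ^ (p - 1))
  have hI : Integrable (fun u => ‖zoDirection f σ x u‖ ^ p)
      (stdGaussian (EuclideanSpace ℝ (Fin d))) := by
    refine hint.mono' (by fun_prop) (Eventually.of_forall fun u => ?_)
    rw [Real.norm_of_nonneg (by positivity)]
    exact hpt u
  refine ⟨hI, (integral_mono hI hint hpt).trans ?_⟩
  have e1 := integral_norm_pow_stdGaussian_le (E := EuclideanSpace ℝ (Fin d)) (2 * p)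
  have e2 := integral_norm_pow_stdGaussian_le (E := EuclideanSpace ℝ (Fin d)) ((m + 2) * p)
  simp only [finrank_euclideanSpace_fin] at e1 e2
  push_cast at e1 e2
  rw [show (2 * (p : ℝ)) / 2 = p by ring, Real.rpow_natCast] at e1
  simp only [Pi.add_apply]
  rw [integral_const_mul, integral_add hi1 hi2, integral_const_mul, integral_const_mul, constH,
    if_neg (by omega), hcp, mul_assoc ((3 : ℝ) ^ (p - 1))]
  refine mul_le_mul_of_nonneg_left ?_ (by positivity)
  set a := c ^ p * R₁ ^ p * (2 * (p : ℝ) + d) ^ p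
  set b := R₂ ^ p * (2 * (p : ℝ) + d) ^ p +
    c ^ p * R₁ ^ p * σ ^ (m * p) * (((m : ℝ) + 2) * p + d) ^ ((((m : ℝ) + 2) * p) / 2)
  calc _ ≤ (c ^ p * R₁ ^ p * ‖x‖ ^ (m * p) + R₂ ^ p) * (2 * (p : ℝ) + d) ^ p +
        c ^ p * R₁ ^ p * σ ^ (m * p) * (((m : ℝ) + 2) * p + d) ^ ((((m : ℝ) + 2) * p) / 2) := by
        gcongr
    _ = a * ‖x‖ ^ (m * p) + b * 1 := by ring
    _ ≤ max a b * ‖x‖ ^ (m * p) + max a b * 1 := by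
        gcongr
        · exact le_max_left _ _
        · exact le_max_right _ _
    _ = _ := by ring

theorem constH_nonneg (hR : 0 ≤ R₁) (p : ℕ) : 0 ≤ constH d m R₁ R₂ σ p := by
  unfold constH
  split_ifs
  · exact zero_le_one
  · exact mul_nonneg (by positivity) (le_max_of_le_left (by positivity))

theorem IsSPB.integrable_zoDirection (hf : IsSPB f R₁ R₂ m) (hm : 1 ≤ m) (hσ : 0 < σ)
    (x : EuclideanSpace ℝ (Fin d)) :
    Integrable (zoDirection f σ x) (stdGaussian (EuclideanSpace ℝ (Fin d))) := by
  have := (hf.integral_norm_zoDirection_pow_le hm hσ le_rfl x).1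
  simp only [pow_one] at this
  exact (integrable_norm_iff (hf.continuous_zoDirection x).aestronglyMeasurable).1 this

/-- The direction is unbiased: the subtracted `f x • u` has mean zero. -/
theorem IsSPB.integral_zoDirection (hf : IsSPB f R₁ R₂ m) (hσ : 0 < σ)
    (x : EuclideanSpace ℝ (Fin d)) :
    ∫ u, zoDirection f σ x u ∂stdGaussian (EuclideanSpace ℝ (Fin d)) =
      smoothingGradient f σ x := by
  have h : ∀ u, zoDirection f σ x u = σ⁻¹ • (f (x + σ • u) • u - f x • u) := fun u => by
    rw [zoDirection, ← sub_smul, smul_smul, div_eq_inv_mul]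
  have hid : Integrable (fun u => f x • u) (stdGaussian (EuclideanSpace ℝ (Fin d))) :=
    IsGaussian.integrable_fun_id.smul (f x)
  simp_rw [h]
  rw [integral_smul, integral_sub (hf.integrable_add_smul_smul hσ.le x)
    hid, integral_smul, integral_id_stdGaussian, smul_zero,
    sub_zero, smoothingGradient]

/-- The normalisation absorbs the growth `‖x‖ ^ m` of the direction, leaving a bound linear in `1 +
‖x‖`. Linearity lets moments of a fixed order propagate along the iterates. -/
theorem IsSPB.exists_one_add_norm_zoStep_le (hf : IsSPB f R₁ R₂ m) (hσ : 0 < σ) (t : ℝ) :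
    ∃ K, 0 ≤ K ∧ ∀ x u : EuclideanSpace ℝ (Fin d),
      1 + ‖zoStep f m σ t x u‖ ≤ K * (1 + ‖x‖) * (1 + ‖u‖) ^ (m + 2) := by
  have hR := hf.R₁_nonneg
  have hR2 := hf.R₂_pos.le
  set c : ℝ := 2 ^ (m - 1) with hc
  have hc0 : 0 ≤ c := by positivity
  refine ⟨1 + |t| * (c * R₁ * (1 + σ ^ m) + R₂), by positivity, fun x u => ?_⟩
  set q := ‖x‖ ^ (2 * m) + 1 with hq
  have hq1 : 1 ≤ q := by rw [hq]; linarith [show 0 ≤ ‖x‖ ^ (2 * m) by positivity]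
  have hsq : ‖x‖ ^ m ≤ q := by
    rw [hq, mul_comm, pow_mul]
    nlinarith [sq_nonneg (‖x‖ ^ m - 1)]
  have hu0 : ‖u‖ ≤ 1 + ‖u‖ := by linarith
  have hu : ‖u‖ ^ m ≤ (1 + ‖u‖) ^ m := by gcongr
  have hu1 : 1 ≤ (1 + ‖u‖) ^ m := one_le_pow₀ (by linarith [norm_nonneg u])
  have hu2 : 1 ≤ (1 + ‖u‖) ^ (m + 2) := one_le_pow₀ (by linarith [norm_nonneg u])
  have hV : ‖zoDirection f σ x u‖ ≤ q * ((c * R₁ * (1 + σ ^ m) + R₂) * (1 + ‖u‖) ^ (m + 2)) := by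
    refine (hf.norm_zoDirection_le hσ x u).trans ?_
    calc (c * R₁ * (‖x‖ ^ m + σ ^ m * ‖u‖ ^ m) + R₂) * ‖u‖ ^ 2
        ≤ (c * R₁ * (q * (1 + ‖u‖) ^ m + σ ^ m * (q * (1 + ‖u‖) ^ m)) +
            R₂ * (q * (1 + ‖u‖) ^ m)) * (1 + ‖u‖) ^ 2 := by
          have h1 : 1 ≤ q * (1 + ‖u‖) ^ m := one_le_mul_of_one_le_of_one_le hq1 hu1
          gcongr
          · exact hsq.trans (le_mul_of_one_le_right (by positivity) hu1)
          · exact hu.trans (le_mul_of_one_le_left (by positivity) hq1)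
          · exact le_mul_of_one_le_right hR2 h1
      _ = _ := by ring
  have hstep : ‖(t / q) • zoDirection f σ x u‖ ≤
      |t| * (c * R₁ * (1 + σ ^ m) + R₂) * (1 + ‖u‖) ^ (m + 2) := by
    rw [norm_smul, Real.norm_eq_abs, abs_div, abs_of_pos (by linarith : (0 : ℝ) < q)]
    calc |t| / q * ‖zoDirection f σ x u‖ ≤
        |t| / q * (q * ((c * R₁ * (1 + σ ^ m) + R₂) * (1 + ‖u‖) ^ (m + 2))) := by gcongr
      _ = _ := by field_simp
  have hn : ‖zoStep f m σ t x u‖ ≤ ‖x‖ + ‖(t / q) • zoDirection f σ x u‖ := norm_sub_le _ _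
  calc 1 + ‖zoStep f m σ t x u‖
      ≤ (1 + ‖x‖) * 1 + 1 * (|t| * (c * R₁ * (1 + σ ^ m) + R₂) * (1 + ‖u‖) ^ (m + 2)) := by
        linarith
    _ ≤ (1 + ‖x‖) * (1 + ‖u‖) ^ (m + 2) + (1 + ‖x‖) *
        (|t| * (c * R₁ * (1 + σ ^ m) + R₂) * (1 + ‖u‖) ^ (m + 2)) := by
        gcongr
        linarith [norm_nonneg x]
    _ = _ := by ring

theorem IsSPB.exists_abs_gaussianSmoothing_zoStep_le (hf : IsSPB f R₁ R₂ m) (hσ : 0 < σ) (t : ℝ) :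
    ∃ K, 0 ≤ K ∧ ∀ x u : EuclideanSpace ℝ (Fin d), |gaussianSmoothing f σ (zoStep f m σ t x u)| ≤
      K * (1 + ‖x‖) ^ (m + 1) * (1 + ‖u‖) ^ ((m + 2) * (m + 1)) := by
  obtain ⟨K₁, hK₁, h₁⟩ := hf.exists_abs_gaussianSmoothing_le hσ.le
  obtain ⟨K₂, hK₂, h₂⟩ := hf.exists_one_add_norm_zoStep_le hσ t
  refine ⟨K₁ * K₂ ^ (m + 1), by positivity, fun x u => (h₁ _).trans ?_⟩
  calc _ ≤ K₁ * (K₂ * (1 + ‖x‖) * (1 + ‖u‖) ^ (m + 2)) ^ (m + 1) := by gcongr; exact h₂ x u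
    _ = _ := by rw [mul_pow, mul_pow, ← pow_mul]; ring

theorem IsSPB.integrable_gaussianSmoothing_zoStep (hf : IsSPB f R₁ R₂ m) (hσ : 0 < σ) (t : ℝ)
    (x : EuclideanSpace ℝ (Fin d)) :
    Integrable (fun u => gaussianSmoothing f σ (zoStep f m σ t x u))
      (stdGaussian (EuclideanSpace ℝ (Fin d))) := by
  obtain ⟨K, hK, h⟩ := hf.exists_abs_gaussianSmoothing_zoStep_le hσ t
  have hc : Continuous fun u => gaussianSmoothing f σ (zoStep f m σ t x u) :=
    (hf.continuous_gaussianSmoothing hσ).comp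
      ((hf.continuous_uncurry_zoStep t).comp (by fun_prop : Continuous fun u => (x, u)))
  exact ((integrable_one_add_norm_pow_stdGaussian ((m + 2) * (m + 1))).const_mul _).mono'
    hc.aestronglyMeasurable (Eventually.of_forall fun u => h x u)

theorem pow_add_one_le_sq_add_one_pow {s : ℝ} (hs : 0 ≤ s) {p : ℕ} (hp : 2 ≤ p) :
    s ^ p + 1 ≤ (s ^ 2 + 1) ^ p := by
  rcases le_total s 1 with h | h
  · have h1 : s ^ p ≤ s ^ 2 := pow_le_pow_of_le_one hs h hp
    have h2 : s ^ 2 + 1 ≤ (s ^ 2 + 1) ^ p := le_self_pow₀ (by nlinarith) (by omega)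
    linarith
  · calc s ^ p + 1 ≤ (s ^ 2) ^ p + 1 ^ p := by
          rw [one_pow]; gcongr; nlinarith
      _ ≤ (s ^ 2 + 1) ^ p := pow_add_pow_le (by positivity) zero_le_one (by omega)

theorem mul_norm_one_div_smul_sq_le {E : Type*} [SeminormedAddCommGroup E] [NormedSpace ℝ E]
    {s t : ℝ} (ht : 0 ≤ t) (hs : 0 ≤ s) (G : E) :
    t * ‖(1 / (s + 1)) • G‖ ^ 2 ≤ t / (s ^ 2 + 1) * ‖G‖ ^ 2 := by
  rw [norm_smul, mul_pow, Real.norm_of_nonneg (by positivity), ← mul_assoc, div_pow, one_pow,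
    mul_one_div]
  gcongr
  nlinarith

/-- With `s = ‖x‖ ^ m`, one factor `s² + 1` of the squared normaliser cancels the growth of the
modulus, the other that of the second moment. -/
theorem quadratic_term_le {A B H J s : ℝ} (hA : 0 ≤ A) (hB : 0 ≤ B) (hH : 0 ≤ H) (hs : 0 ≤ s)
    (hJ : J ≤ H * (s ^ 2 + 1)) (t : ℝ) :
    (A + B * s) / 2 * (t / (s ^ 2 + 1)) ^ 2 * J ≤ H * (A + B) / 2 * t ^ 2 := by
  have hq0 : 0 < s ^ 2 + 1 := by positivity
  have hAB : A + B * s ≤ (A + B) * (s ^ 2 + 1) := by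
    nlinarith [mul_nonneg hA (sq_nonneg s), mul_nonneg hB (sq_nonneg (s - 1)),
      mul_nonneg hB (sq_nonneg s)]
  calc _ ≤ (A + B * s) / 2 * (t / (s ^ 2 + 1)) ^ 2 * (H * (s ^ 2 + 1)) := by gcongr
    _ ≤ (A + B) * (s ^ 2 + 1) / 2 * (t / (s ^ 2 + 1)) ^ 2 * (H * (s ^ 2 + 1)) := by gcongr
    _ = _ := by field_simp

theorem higher_order_term_le {C H J s t : ℝ} (hC : 0 ≤ C) (hH : 0 ≤ H) (hs : 0 ≤ s) (ht : 0 ≤ t)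
    (m : ℕ) (hJ : J ≤ H * (s ^ (m + 2) + 1)) :
    C / ((m : ℝ) + 2) * (t / (s ^ 2 + 1)) ^ (m + 2) * J ≤
      H * C / ((m : ℝ) + 2) * t ^ (m + 2) := by
  have hq0 : 0 < s ^ 2 + 1 := by positivity
  calc _ ≤ C / ((m : ℝ) + 2) * (t / (s ^ 2 + 1)) ^ (m + 2) * (H * (s ^ 2 + 1) ^ (m + 2)) := by
        gcongr
        refine hJ.trans ?_
        gcongr
        exact pow_add_one_le_sq_add_one_pow hs (by omega)
    _ = _ := by rw [div_pow]; field_simp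

/-- The expected decrease of the Gaussian smoothing in one step of the algorithm. -/
theorem IsSPB.integral_gaussianSmoothing_zoStep_le (hf : IsSPB f R₁ R₂ m) (hm : 1 ≤ m)
    (hσ : 0 < σ) {t : ℝ} (ht : 0 ≤ t) (x : EuclideanSpace ℝ (Fin d)) :
    ∫ u, gaussianSmoothing f σ (zoStep f m σ t x u) ∂stdGaussian (EuclideanSpace ℝ (Fin d)) ≤
      gaussianSmoothing f σ x - t * ‖(1 / (‖x‖ ^ m + 1)) • smoothingGradient f σ x‖ ^ 2 +
      constH d m R₁ R₂ σ 2 * (constA d m R₁ R₂ σ + constB d m R₁ σ) / 2 * t ^ 2 +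
      constH d m R₁ R₂ σ (m + 2) * constC d m R₁ σ / ((m : ℝ) + 2) * t ^ (m + 2) := by
  have hA := constA_nonneg (d := d) (m := m) hf.R₁_nonneg hf.R₂_pos.le hσ.le
  have hB := constB_nonneg (d := d) (m := m) hf.R₁_nonneg hσ.le
  have hC := constC_nonneg (d := d) (m := m) hf.R₁_nonneg hσ.le
  have hH2 := constH_nonneg (d := d) (m := m) (R₂ := R₂) (σ := σ) hf.R₁_nonneg 2
  have hHm := constH_nonneg (d := d) (m := m) (R₂ := R₂) (σ := σ) hf.R₁_nonneg (m + 2)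
  obtain ⟨hI2, hV2⟩ := hf.integral_norm_zoDirection_pow_le hm hσ one_le_two x
  obtain ⟨hIm, hVm⟩ := hf.integral_norm_zoDirection_pow_le hm hσ (by omega : 1 ≤ m + 2) x
  have hIV := hf.integrable_zoDirection hm hσ x
  set A := constA d m R₁ R₂ σ
  set B := constB d m R₁ σ
  set C := constC d m R₁ σ
  set H₂ := constH d m R₁ R₂ σ 2
  set H := constH d m R₁ R₂ σ (m + 2)
  set s := ‖x‖ ^ m with hs
  have hs0 : 0 ≤ s := by positivity
  set q := s ^ 2 + 1 with hq
  have hq0 : 0 < q := by positivity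
  set G := smoothingGradient f σ x
  set α := t / q with hα
  have hα0 : 0 ≤ α := by positivity
  rw [pow_mul, ← hs] at hV2 hVm
  have hpt : ∀ u, gaussianSmoothing f σ (zoStep f m σ t x u) ≤
      (gaussianSmoothing f σ x - α * inner ℝ G (zoDirection f σ x u)) +
      ((A + B * s) / 2 * α ^ 2 * ‖zoDirection f σ x u‖ ^ 2 +
      C / ((m : ℝ) + 2) * α ^ (m + 2) * ‖zoDirection f σ x u‖ ^ (m + 2)) := by
    intro u
    have h := hf.gaussianSmoothing_add_le hm hσ x (-(α • zoDirection f σ x u))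
    have hx : x + -(α • zoDirection f σ x u) = zoStep f m σ t x u := by
      rw [zoStep, mul_comm 2 m, pow_mul, ← hs, ← hq, ← hα, sub_eq_add_neg]
    rw [hx, norm_neg, norm_smul, Real.norm_of_nonneg hα0, inner_neg_right, real_inner_smul_right,
      mul_pow, mul_pow] at h
    refine h.trans (le_of_eq ?_)
    ring
  have hinner : Integrable (fun u => α * inner ℝ G (zoDirection f σ x u))
    (stdGaussian (EuclideanSpace ℝ (Fin d))) := (hIV.const_inner G).const_mul α
  have hi1 : Integrable (fun u => gaussianSmoothing f σ x - α * inner ℝ G (zoDirection f σ x u))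
    (stdGaussian (EuclideanSpace ℝ (Fin d))) := (integrable_const _).sub hinner
  have hi2 := hI2.const_mul ((A + B * s) / 2 * α ^ 2)
  have hi3 := hIm.const_mul (C / ((m : ℝ) + 2) * α ^ (m + 2))
  have hi23 : Integrable (fun u => (A + B * s) / 2 * α ^ 2 * ‖zoDirection f σ x u‖ ^ 2 +
      C / ((m : ℝ) + 2) * α ^ (m + 2) * ‖zoDirection f σ x u‖ ^ (m + 2))
    (stdGaussian (EuclideanSpace ℝ (Fin d))) := hi2.add hi3
  have hmono : _ ≤ ∫ u, ((gaussianSmoothing f σ x - α * inner ℝ G (zoDirection f σ x u)) +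
      ((A + B * s) / 2 * α ^ 2 * ‖zoDirection f σ x u‖ ^ 2 +
      C / ((m : ℝ) + 2) * α ^ (m + 2) * ‖zoDirection f σ x u‖ ^ (m + 2)))
      ∂stdGaussian (EuclideanSpace ℝ (Fin d)) :=
    integral_mono (hf.integrable_gaussianSmoothing_zoStep hσ t x) (hi1.add hi23) hpt
  have heq : ∫ u, (gaussianSmoothing f σ x -
      α * inner ℝ G (zoDirection f σ x u)) ∂stdGaussian (EuclideanSpace ℝ (Fin d)) =
      gaussianSmoothing f σ x - α * ‖G‖ ^ 2 := by
    rw [integral_sub (integrable_const _) hinner, integral_const_mul, integral_inner hIV,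
      hf.integral_zoDirection hσ x, real_inner_self_eq_norm_sq]
    simp
  rw [integral_add hi1 hi23, heq, integral_add hi2 hi3, integral_const_mul,
    integral_const_mul] at hmono
  have t1 := mul_norm_one_div_smul_sq_le ht hs0 G
  have t2 := quadratic_term_le hA hB hH2 hs0 hV2 t
  have t3 := higher_order_term_le hC hHm hs0 ht m hVm
  rw [← hq, ← hα] at t1 t2 t3
  linarith

end OneStep

/-! ### Independence, integrability and decrease along the iterates; consequences of quadratic
growth. -/

section Iterates

variable {Ω : Type*} [MeasurableSpace Ω] {P : Measure Ω}

/-- A process driven by independent innovations is independent of the current innovation. -/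
theorem ProbabilityTheory.iIndepFun.indepFun_of_recursion {α β : Type*} [MeasurableSpace α]
    [MeasurableSpace β] {U : ℕ → Ω → β} {X : ℕ → Ω → α} (hind : iIndepFun U P)
    (hU : ∀ k, Measurable (U k)) {F : ℕ → α → β → α}
    (hF : ∀ k, Measurable fun p : α × β => F k p.1 p.2) {x0 : α} (h0 : ∀ ω, X 0 ω = x0)
    (hs : ∀ k ω, X (k + 1) ω = F k (X k ω) (U k ω)) (k : ℕ) :
    Measurable (X k) ∧ IndepFun (X k) (U k) P := by
  -- The state at time `k` depends only on the innovations of index below `k`, whose σ-algebra is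
  -- independent of that of `U k`.
  have hm : ∀ k, Measurable[⨆ j ∈ Set.Iio k, MeasurableSpace.comap (U j) inferInstance] (X k) := by
    intro k
    induction k with
    | zero =>
      rw [funext h0]
      exact measurable_const
    | succ k ih =>
      rw [funext (hs k)]
      refine (hF k).comp (Measurable.prodMk ?_ ?_)
      · exact ih.mono (biSup_mono fun j (hj : j < k) => (Nat.lt_succ_of_lt hj : j < k + 1)) le_rfl
      · exact (comap_measurable (U k)).mono
          (le_biSup (fun j => MeasurableSpace.comap (U j) inferInstance)
            (Set.mem_Iio.2 (Nat.lt_succ_self k))) le_rfl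
  have hle : ∀ j, MeasurableSpace.comap (U j) inferInstance ≤ ‹MeasurableSpace Ω› :=
    fun j => (hU j).comap_le
  refine ⟨(hm k).mono (iSup₂_le fun j _ => hle j) le_rfl, ?_⟩
  have hdisj : Disjoint (Set.Iio k) {k} := by simp
  have h := indep_iSup_of_disjoint hle hind hdisj
  rw [IndepFun_iff_Indep]
  refine indep_of_indep_of_le_right (indep_of_indep_of_le_left h (hm k).comap_le) ?_
  simp

/-- Fubini for the product law replaces conditioning on the current iterate. -/
theorem ProbabilityTheory.IndepFun.integral_comp_prodMk {α β : Type*} [MeasurableSpace α]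
    [MeasurableSpace β] [IsProbabilityMeasure P] {X : Ω → α} {V : Ω → β} (h : IndepFun X V P)
    (hX : Measurable X) (hV : Measurable V) {Φ : α × β → ℝ} (hΦ : Measurable Φ)
    (hint : Integrable (fun ω => Φ (X ω, V ω)) P) :
    ∫ ω, Φ (X ω, V ω) ∂P = ∫ ω, ∫ v, Φ (X ω, v) ∂(P.map V) ∂P ∧
      Integrable (fun ω => ∫ v, Φ (X ω, v) ∂(P.map V)) P := by
  have := Measure.isProbabilityMeasure_map (μ := P) hX.aemeasurable
  have := Measure.isProbabilityMeasure_map (μ := P) hV.aemeasurable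
  have hmap := (indepFun_iff_map_prod_eq_prod_map_map hX.aemeasurable hV.aemeasurable).1 h
  have hXV : Measurable fun ω => (X ω, V ω) := hX.prodMk hV
  have hint' : Integrable Φ ((P.map X).prod (P.map V)) := by
    rw [← hmap]
    exact (integrable_map_measure hΦ.aestronglyMeasurable hXV.aemeasurable).2 hint
  have hinner := hint'.integral_prod_left
  constructor
  · rw [← integral_map hXV.aemeasurable hΦ.aestronglyMeasurable, hmap, integral_prod _ hint',
      integral_map hX.aemeasurable hinner.aestronglyMeasurable]
  · exact (integrable_map_measure hinner.aestronglyMeasurable hX.aemeasurable).1 hinner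

/-- A Hölder estimate for fractional moments of a product. -/
theorem integral_mul_rpow_le [IsProbabilityMeasure P] {a b : Ω → ℝ} (ha0 : ∀ ω, 0 ≤ a ω)
    (hb0 : ∀ ω, 0 ≤ b ω) (ham : Measurable a) (hbm : Measurable b) {q : ℝ} (hq : 0 < q)
    (hq1 : q ≤ 1) (ha : Integrable (fun ω => a ω ^ 2) P)
    (hb : Integrable (fun ω => b ω ^ (2 * q)) P) :
    ∫ ω, (a ω * b ω) ^ q ∂P ≤ (∫ ω, a ω ^ 2 ∂P) ^ (q / 2) * √(∫ ω, b ω ^ (2 * q) ∂P) := by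
  have hsq : ∀ {c : ℝ}, 0 ≤ c → (c ^ q) ^ 2 = (c ^ 2) ^ q := fun {c} hc => by
    rw [← Real.rpow_natCast, ← Real.rpow_mul hc, ← Real.rpow_natCast c, ← Real.rpow_mul hc,
      mul_comm]
  have haq : Integrable (fun ω => (a ω ^ 2) ^ q) P := by
    refine (ha.add (integrable_const 1)).mono'
      ((ham.pow_const 2).pow_const q).aestronglyMeasurable (Eventually.of_forall fun ω => ?_)
    have h2 : 0 ≤ a ω ^ 2 := sq_nonneg _
    rw [Real.norm_of_nonneg (by positivity), Pi.add_apply]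
    rcases le_total (a ω ^ 2) 1 with h | h
    · linarith [Real.rpow_le_one h2 h hq.le]
    · have := Real.rpow_le_rpow_of_exponent_le h hq1
      rw [Real.rpow_one] at this
      linarith
  have hA : MemLp (fun ω => a ω ^ q) (ENNReal.ofReal 2) P := by
    rw [ENNReal.ofReal_ofNat,
      memLp_two_iff_integrable_sq (ham.pow_const q).aestronglyMeasurable]
    simpa only [hsq (ha0 _)] using haq
  have hsqb : ∀ ω, (b ω ^ q) ^ 2 = b ω ^ (2 * q) := fun ω => by
    rw [← Real.rpow_natCast, ← Real.rpow_mul (hb0 ω), mul_comm]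
    norm_num
  have hB : MemLp (fun ω => b ω ^ q) (ENNReal.ofReal 2) P := by
    rw [ENNReal.ofReal_ofNat,
      memLp_two_iff_integrable_sq (hbm.pow_const q).aestronglyMeasurable]
    simpa only [hsqb] using hb
  have hH := integral_mul_le_Lp_mul_Lq_of_nonneg Real.HolderConjugate.two_two
    (Eventually.of_forall fun ω => Real.rpow_nonneg (ha0 ω) q)
    (Eventually.of_forall fun ω => Real.rpow_nonneg (hb0 ω) q) hA hB
  simp only [Real.rpow_ofNat, hsq (ha0 _), hsqb, ← Real.sqrt_eq_rpow] at hH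
  simp_rw [Real.mul_rpow (ha0 _) (hb0 _)]
  refine hH.trans ?_
  gcongr
  -- After Cauchy–Schwarz, Jensen for the concave power `q ≤ 1` takes the exponent outside the mean
  -- of `a²`.
  have hJ := (Real.concaveOn_rpow hq.le hq1).le_map_integral (μ := P) (f := fun ω => a ω ^ 2)
    (Real.continuous_rpow_const hq.le).continuousOn isClosed_Ici
    (Eventually.of_forall fun ω => sq_nonneg (a ω)) ha haq
  rw [div_eq_mul_one_div, Real.rpow_mul (integral_nonneg fun ω => sq_nonneg _),
    ← Real.sqrt_eq_rpow]
  exact Real.sqrt_le_sqrt hJ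

variable {d : ℕ} {f : EuclideanSpace ℝ (Fin d) → ℝ} {R₁ R₂ : ℝ} {m : ℕ} {σ : ℝ} {τ : ℕ → ℝ}
  {x0 : EuclideanSpace ℝ (Fin d)} {U X : ℕ → Ω → EuclideanSpace ℝ (Fin d)}

theorem IsSPB.measurable_and_indepFun (hf : IsSPB f R₁ R₂ m) (hU : ∀ k, Measurable (U k))
    (hind : iIndepFun U P) (h0 : ∀ ω, X 0 ω = x0)
    (hs : ∀ k ω, X (k + 1) ω = zoStep f m σ (τ k) (X k ω) (U k ω)) (k : ℕ) :
    Measurable (X k) ∧ IndepFun (X k) (U k) P :=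
  hind.indepFun_of_recursion hU (F := fun k => zoStep f m σ (τ k))
    (fun k => (hf.continuous_uncurry_zoStep (τ k)).measurable) h0 hs k

theorem integrable_one_add_norm_pow_of_map_eq {V : Ω → EuclideanSpace ℝ (Fin d)}
    (hV : Measurable V) (hlaw : P.map V = stdGaussian (EuclideanSpace ℝ (Fin d))) (p : ℕ) :
    Integrable (fun ω => (1 + ‖V ω‖) ^ p) P := by
  have h := integrable_one_add_norm_pow_stdGaussian (E := EuclideanSpace ℝ (Fin d)) p
  rw [← hlaw] at h
  exact (integrable_map_measure (g := fun u : EuclideanSpace ℝ (Fin d) => (1 + ‖u‖) ^ p)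
    (by fun_prop) hV.aemeasurable).1 h

theorem IsSPB.integrable_one_add_norm_iterate_pow [IsProbabilityMeasure P]
    (hf : IsSPB f R₁ R₂ m) (hσ : 0 < σ)
    (hU : ∀ k, Measurable (U k)) (hind : iIndepFun U P)
    (hlaw : ∀ k, P.map (U k) = stdGaussian (EuclideanSpace ℝ (Fin d))) (h0 : ∀ ω, X 0 ω = x0)
    (hs : ∀ k ω, X (k + 1) ω = zoStep f m σ (τ k) (X k ω) (U k ω)) (k p : ℕ) :
    Integrable (fun ω => (1 + ‖X k ω‖) ^ p) P := by
  have hXm := hf.measurable_and_indepFun hU hind h0 hs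
  induction k with
  | zero => simp [h0]
  | succ k ih =>
    obtain ⟨K, hK, h⟩ := hf.exists_one_add_norm_zoStep_le hσ (τ k)
    have hi : IndepFun (fun ω => (1 + ‖X k ω‖) ^ p) (fun ω => (1 + ‖U k ω‖) ^ ((m + 2) * p)) P :=
      (hXm k).2.comp (φ := fun x => (1 + ‖x‖) ^ p) (ψ := fun u => (1 + ‖u‖) ^ ((m + 2) * p))
        (by fun_prop) (by fun_prop)
    have hprod := (hi.integrable_mul ih
      (integrable_one_add_norm_pow_of_map_eq (hU k) (hlaw k) _)).const_mul (K ^ p)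
    refine hprod.mono' ?_ (Eventually.of_forall fun ω => ?_)
    · have := (hXm (k + 1)).1
      fun_prop
    · rw [Real.norm_of_nonneg (by positivity), hs]
      calc _ ≤ (K * (1 + ‖X k ω‖) * (1 + ‖U k ω‖) ^ (m + 2)) ^ p := by gcongr; exact h _ _
        _ = _ := by simp only [Pi.mul_apply]; rw [mul_pow, mul_pow, ← pow_mul, mul_assoc]

theorem integrable_comp_of_growth {Y : Ω → EuclideanSpace ℝ (Fin d)} (hY : Measurable Y)
    (hp : ∀ p : ℕ, Integrable (fun ω => (1 + ‖Y ω‖) ^ p) P) {g : EuclideanSpace ℝ (Fin d) → ℝ}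
    (hg : Continuous g) {K : ℝ} {N : ℕ} (hK : ∀ x, |g x| ≤ K * (1 + ‖x‖) ^ N) :
    Integrable (fun ω => g (Y ω)) P :=
  ((hp N).const_mul K).mono' (hg.measurable.comp hY).aestronglyMeasurable
    (Eventually.of_forall fun ω => hK (Y ω))

theorem IsSPB.continuous_scaledGradient (hf : IsSPB f R₁ R₂ m) (hm : 1 ≤ m) (hσ : 0 < σ) :
    Continuous fun x => (1 / (‖x‖ ^ m + 1)) • smoothingGradient f σ x := by
  have hc := hf.continuous_smoothingGradient hm hσ
  have h : ∀ x : EuclideanSpace ℝ (Fin d), ‖x‖ ^ m + 1 ≠ 0 := fun x => by positivity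
  fun_prop (disch := assumption)

theorem norm_scaledGradient_le (x : EuclideanSpace ℝ (Fin d)) :
    ‖(1 / (‖x‖ ^ m + 1)) • smoothingGradient f σ x‖ ≤ ‖smoothingGradient f σ x‖ := by
  rw [norm_smul, Real.norm_of_nonneg (by positivity)]
  refine mul_le_of_le_one_left (norm_nonneg _) ?_
  rw [div_le_one (by positivity)]
  linarith [show 0 ≤ ‖x‖ ^ m by positivity]

theorem IsSPB.integrable_norm_scaledGradient_sq (hf : IsSPB f R₁ R₂ m) (hm : 1 ≤ m) (hσ : 0 < σ)
    {Y : Ω → EuclideanSpace ℝ (Fin d)} (hY : Measurable Y)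
    (hp : ∀ p : ℕ, Integrable (fun ω => (1 + ‖Y ω‖) ^ p) P) :
    Integrable (fun ω => ‖(1 / (‖Y ω‖ ^ m + 1)) • smoothingGradient f σ (Y ω)‖ ^ 2) P := by
  obtain ⟨K, hK, h⟩ := hf.exists_norm_smoothingGradient_le hm hσ
  refine integrable_comp_of_growth hY hp
    (g := fun x => ‖(1 / (‖x‖ ^ m + 1)) • smoothingGradient f σ x‖ ^ 2)
    ((hf.continuous_scaledGradient hm hσ).norm.pow 2) (K := K ^ 2) (N := (m + 1) * 2) fun x => ?_
  rw [abs_of_nonneg (by positivity), pow_mul, ← mul_pow]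
  exact pow_le_pow_left₀ (norm_nonneg _) ((norm_scaledGradient_le x).trans (h x)) 2

theorem IsSPB.integrable_gaussianSmoothing_comp (hf : IsSPB f R₁ R₂ m) (hσ : 0 < σ)
    {Y : Ω → EuclideanSpace ℝ (Fin d)} (hY : Measurable Y)
    (hp : ∀ p : ℕ, Integrable (fun ω => (1 + ‖Y ω‖) ^ p) P) :
    Integrable (fun ω => gaussianSmoothing f σ (Y ω)) P := by
  obtain ⟨K, hK, h⟩ := hf.exists_abs_gaussianSmoothing_le hσ.le
  exact integrable_comp_of_growth hY hp (hf.continuous_gaussianSmoothing hσ) h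

theorem IsSPB.integrable_norm_smoothingGradient_rpow [IsProbabilityMeasure P]
    (hf : IsSPB f R₁ R₂ m) (hm : 1 ≤ m)
    (hσ : 0 < σ) {Y : Ω → EuclideanSpace ℝ (Fin d)} (hY : Measurable Y)
    (hp : ∀ p : ℕ, Integrable (fun ω => (1 + ‖Y ω‖) ^ p) P) {q : ℝ} (hq : 0 ≤ q) (hq1 : q ≤ 1) :
    Integrable (fun ω => ‖smoothingGradient f σ (Y ω)‖ ^ q) P := by
  obtain ⟨K, hK, h⟩ := hf.exists_norm_smoothingGradient_le hm hσ
  refine integrable_comp_of_growth hY hp (g := fun x => ‖smoothingGradient f σ x‖ ^ q)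
    ((hf.continuous_smoothingGradient hm hσ).norm.rpow_const fun _ => Or.inr hq)
    (K := 1 + K) (N := m + 1) fun x => ?_
  rw [abs_of_nonneg (by positivity)]
  have h1 : (1 : ℝ) ≤ (1 + ‖x‖) ^ (m + 1) := one_le_pow₀ (by linarith [norm_nonneg x])
  have h2 := h x
  have h3 := norm_nonneg (smoothingGradient f σ x)
  rw [add_mul, one_mul]
  rcases le_total ‖smoothingGradient f σ x‖ 1 with hle | hle
  · linarith [Real.rpow_le_one h3 hle hq]
  · have := Real.rpow_le_rpow_of_exponent_le hle hq1
    rw [Real.rpow_one] at this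
    linarith

/-- The expected decrease of the Gaussian smoothing along the iterates. -/
theorem IsSPB.integral_gaussianSmoothing_iterate_succ_le [IsProbabilityMeasure P]
    (hf : IsSPB f R₁ R₂ m) (hm : 1 ≤ m) (hσ : 0 < σ)
    (hU : ∀ k, Measurable (U k)) (hind : iIndepFun U P)
    (hlaw : ∀ k, P.map (U k) = stdGaussian (EuclideanSpace ℝ (Fin d))) (h0 : ∀ ω, X 0 ω = x0)
    (hs : ∀ k ω, X (k + 1) ω = zoStep f m σ (τ k) (X k ω) (U k ω)) (k : ℕ) (ht : 0 ≤ τ k) :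
    ∫ ω, gaussianSmoothing f σ (X (k + 1) ω) ∂P ≤ ∫ ω, gaussianSmoothing f σ (X k ω) ∂P -
      τ k * ∫ ω, ‖(1 / (‖X k ω‖ ^ m + 1)) • smoothingGradient f σ (X k ω)‖ ^ 2 ∂P +
      (constH d m R₁ R₂ σ 2 * (constA d m R₁ R₂ σ + constB d m R₁ σ) / 2 * τ k ^ 2 +
      constH d m R₁ R₂ σ (m + 2) * constC d m R₁ σ / ((m : ℝ) + 2) * τ k ^ (m + 2)) := by
  have hXm := hf.measurable_and_indepFun hU hind h0 hs
  have hp := hf.integrable_one_add_norm_iterate_pow hσ hU hind hlaw h0 hs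
  have hI1 := hf.integrable_gaussianSmoothing_comp hσ (hXm (k + 1)).1 (hp (k + 1))
  have hI := hf.integrable_gaussianSmoothing_comp hσ (hXm k).1 (hp k)
  have hG := hf.integrable_norm_scaledGradient_sq hm hσ (hXm k).1 (hp k)
  simp only [hs k] at hI1 ⊢
  obtain ⟨heq, hint⟩ := (hXm k).2.integral_comp_prodMk (hXm k).1 (hU k)
    (Φ := fun p => gaussianSmoothing f σ (zoStep f m σ (τ k) p.1 p.2))
    ((hf.continuous_gaussianSmoothing hσ).comp (hf.continuous_uncurry_zoStep (τ k))).measurable hI1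
  simp only [hlaw k] at heq hint
  have hrhs : Integrable (fun ω => gaussianSmoothing f σ (X k ω) -
      τ k * ‖(1 / (‖X k ω‖ ^ m + 1)) • smoothingGradient f σ (X k ω)‖ ^ 2) P :=
    hI.sub (hG.const_mul (τ k))
  rw [heq]
  set c := constH d m R₁ R₂ σ 2 * (constA d m R₁ R₂ σ + constB d m R₁ σ) / 2 * τ k ^ 2 +
      constH d m R₁ R₂ σ (m + 2) * constC d m R₁ σ / ((m : ℝ) + 2) * τ k ^ (m + 2)
  refine (integral_mono hint (hrhs.add (integrable_const c)) fun ω => ?_).trans (le_of_eq ?_)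
  · exact (hf.integral_gaussianSmoothing_zoStep_le hm hσ ht (X k ω)).trans (le_of_eq (add_assoc _ _ _))
  · rw [integral_add' hrhs (integrable_const _), integral_sub hI (hG.const_mul _),
      integral_const_mul]
    simp

theorem add_sum_le_of_forall_succ_le {e w c : ℕ → ℝ} {n : ℕ}
    (h : ∀ k < n, e (k + 1) ≤ e k - w k + c k) :
    e n + ∑ k ∈ Finset.range n, w k ≤ e 0 + ∑ k ∈ Finset.range n, c k := by
  induction n with
  | zero => simp
  | succ n ih =>
    rw [Finset.sum_range_succ, Finset.sum_range_succ]
    linarith [ih fun k hk => h k (by omega), h n (by omega)]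

/-- Since `√(T + 1) ≥ 1`, both powers of the step size gain at least `1 / (T + 1)`, and there are at
most `T + 1` terms. -/
theorem sum_constant_stepsize_le {γ c₁ c₂ : ℝ} (hγ : 0 < γ) (hc₁ : 0 ≤ c₁) (hc₂ : 0 ≤ c₂) {T : ℕ}
    (hτ : ∀ k ≤ T, τ k = γ / √((T : ℝ) + 1)) {n : ℕ} (hn : n ≤ T + 1) (m : ℕ) :
    ∑ k ∈ Finset.range n, (c₁ * τ k ^ 2 + c₂ * τ k ^ (m + 2)) ≤
      c₁ * γ ^ 2 + c₂ * γ ^ (m + 2) := by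
  set r := √((T : ℝ) + 1) with hr
  have hr2 : r ^ 2 = (T : ℝ) + 1 := Real.sq_sqrt (by positivity)
  have hr1 : 1 ≤ r := Real.one_le_sqrt.2 (by linarith [(Nat.cast_nonneg T : (0 : ℝ) ≤ T)])
  have hterm : ∀ k ∈ Finset.range n, c₁ * τ k ^ 2 + c₂ * τ k ^ (m + 2) ≤
      (c₁ * γ ^ 2 + c₂ * γ ^ (m + 2)) / r ^ 2 := by
    intro k hk
    rw [Finset.mem_range] at hk
    rw [hτ k (by omega), div_pow, div_pow, add_div, mul_div_assoc, mul_div_assoc]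
    gcongr
    · omega
  have hn' : (n : ℝ) ≤ r ^ 2 := by rw [hr2]; exact_mod_cast hn
  calc _ ≤ n • ((c₁ * γ ^ 2 + c₂ * γ ^ (m + 2)) / r ^ 2) := by
        simpa using Finset.sum_le_card_nsmul _ _ _ hterm
    _ ≤ r ^ 2 * ((c₁ * γ ^ 2 + c₂ * γ ^ (m + 2)) / r ^ 2) := by
        rw [nsmul_eq_mul]; gcongr
    _ = _ := by field_simp

/-- Descent controls `f_σ`, not `f`. So growth is used at `x + σ u`; since the distance to the
minimizers is 1-Lipschitz, averaging over `u` costs only `σ² E‖u‖² = σ² d`, up to a factor. -/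
theorem norm_sq_le_of_quadratic_growth (hf : IsSPB f R₁ R₂ m)
    (hne : (minimizers f).Nonempty) (hbdd : Bornology.IsBounded (minimizers f))
    {μ : ℝ} (hμ : 0 < μ)
    (hgrowth : ∀ x, f x - (⨅ u, f u) ≥ μ / 2 * Metric.infDist x (minimizers f) ^ 2) (hσ : 0 < σ)
    (x : EuclideanSpace ℝ (Fin d)) :
    ‖x‖ ^ 2 ≤ 8 * μ⁻¹ * (gaussianSmoothing f σ x - (⨅ u, f u) + 1 / 2 * μ * σ ^ 2 * d) +
      2 * ⨆ w : minimizers f, ‖(w : EuclideanSpace ℝ (Fin d))‖ ^ 2 := by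
  set S := minimizers f
  set D := Metric.infDist x S
  set s := ⨆ w : S, ‖(w : EuclideanSpace ℝ (Fin d))‖ ^ 2
  have hbs : BddAbove (Set.range fun w : S => ‖(w : EuclideanSpace ℝ (Fin d))‖ ^ 2) := by
    obtain ⟨C, hC⟩ := hbdd.exists_norm_le
    refine ⟨C ^ 2, ?_⟩
    rintro _ ⟨w, rfl⟩
    exact pow_le_pow_left₀ (norm_nonneg _) (hC w w.2) 2
  have hs : 0 ≤ s := Real.iSup_nonneg fun w => by positivity
  have hnorm : ‖x‖ - √s ≤ D := by
    refine (Metric.le_infDist hne).2 fun w hw => ?_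
    have h1 : ‖w‖ ≤ √s := Real.le_sqrt_of_sq_le (le_ciSup hbs ⟨w, hw⟩)
    have h2 : ‖x‖ ≤ ‖x - w‖ + ‖w‖ := by simpa using norm_add_le (x - w) w
    rw [dist_eq_norm]
    linarith
  have hD0 : 0 ≤ D := Metric.infDist_nonneg
  have hx : ‖x‖ ^ 2 ≤ 2 * D ^ 2 + 2 * s := by
    have h1 : ‖x‖ ^ 2 ≤ (D + √s) ^ 2 := pow_le_pow_left₀ (norm_nonneg _) (by linarith) 2
    have h2 := Real.sq_sqrt hs
    nlinarith [sq_nonneg (D - √s)]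
  have hpt : ∀ u, D ^ 2 ≤ 4 * μ⁻¹ * (f (x + σ • u) - ⨅ u, f u) + 2 * σ ^ 2 * ‖u‖ ^ 2 := by
    intro u
    have h1 : D ≤ Metric.infDist (x + σ • u) S + σ * ‖u‖ := by
      refine (Metric.infDist_le_infDist_add_dist (y := x + σ • u)).trans_eq ?_
      rw [dist_self_add_right, norm_smul, Real.norm_of_nonneg hσ.le]
    have h2 := pow_le_pow_left₀ hD0 h1 2
    have h3 : 2 * Metric.infDist (x + σ • u) S ^ 2 ≤ 4 * μ⁻¹ * (f (x + σ • u) - ⨅ u, f u) := by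
      calc _ = 4 * μ⁻¹ * (μ / 2 * Metric.infDist (x + σ • u) S ^ 2) := by field_simp; ring
        _ ≤ _ := by gcongr; exact hgrowth _
    nlinarith [sq_nonneg (Metric.infDist (x + σ • u) S - σ * ‖u‖)]
  have hi1 : Integrable (fun u => 4 * μ⁻¹ * (f (x + σ • u) - ⨅ u, f u))
      (stdGaussian (EuclideanSpace ℝ (Fin d))) :=
    ((hf.integrable_add_smul hσ.le x).sub (integrable_const _)).const_mul _
  have hi2 : Integrable (fun u => 2 * σ ^ 2 * ‖u‖ ^ 2)
      (stdGaussian (EuclideanSpace ℝ (Fin d))) :=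
    (integrable_norm_pow_stdGaussian 2).const_mul _
  have hmono := integral_mono (integrable_const (D ^ 2)) (hi1.add hi2) hpt
  rw [integral_add' hi1 hi2, integral_const_mul, integral_const_mul,
    integral_sub (hf.integrable_add_smul hσ.le x) (integrable_const _),
    integral_norm_sq_stdGaussian, finrank_euclideanSpace_fin] at hmono
  simp only [integral_const, probReal_univ, one_smul] at hmono
  have hμi : μ⁻¹ * μ = 1 := inv_mul_cancel₀ hμ.ne'
  have : 8 * μ⁻¹ * (gaussianSmoothing f σ x - (⨅ u, f u) + 1 / 2 * μ * σ ^ 2 * d) =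
      2 * (4 * μ⁻¹ * (gaussianSmoothing f σ x - (⨅ u, f u)) + 2 * σ ^ 2 * d) := by
    field_simp
    ring
  rw [this]
  rw [← gaussianSmoothing] at hmono
  linarith

/-- This is where the exponent of the rate is decided: `m q ≤ 1` reduces the weight to a second
moment. -/
theorem norm_pow_add_one_rpow_le {E : Type*} [SeminormedAddCommGroup E] (x : E) {m : ℕ} {q : ℝ}
    (hq : 0 ≤ q) (hmq : m * q ≤ 1) :
    (‖x‖ ^ m + 1) ^ (2 * q) ≤ (2 ^ q) ^ 2 * (1 + ‖x‖ ^ 2) := by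
  have h1 : (1 : ℝ) ≤ 1 + ‖x‖ ^ 2 := by linarith [sq_nonneg ‖x‖]
  have h2 : ‖x‖ ^ m ≤ (1 + ‖x‖ ^ 2) ^ ((m : ℝ) / 2) := by
    calc ‖x‖ ^ m = (‖x‖ ^ 2) ^ ((m : ℝ) / 2) := by
          rw [← Real.rpow_natCast ‖x‖ 2, ← Real.rpow_mul (norm_nonneg _), Nat.cast_ofNat,
            mul_div_cancel₀ _ two_ne_zero, Real.rpow_natCast]
      _ ≤ _ := by gcongr; linarith
  have h3 : 1 ≤ (1 + ‖x‖ ^ 2) ^ ((m : ℝ) / 2) := Real.one_le_rpow h1 (by positivity)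
  calc (‖x‖ ^ m + 1) ^ (2 * q) ≤ (2 * (1 + ‖x‖ ^ 2) ^ ((m : ℝ) / 2)) ^ (2 * q) := by
        gcongr; linarith
    _ = (2 ^ q) ^ 2 * (1 + ‖x‖ ^ 2) ^ (m * q) := by
        rw [Real.mul_rpow (by norm_num) (by positivity), ← Real.rpow_mul (by positivity),
          ← Real.rpow_natCast (2 ^ q), ← Real.rpow_mul (by norm_num)]
        congr 2
        · push_cast; ring
        · ring
    _ ≤ (2 ^ q) ^ 2 * (1 + ‖x‖ ^ 2) ^ (1 : ℝ) := by gcongr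
    _ = _ := by rw [Real.rpow_one]

end Iterates

/-! ### Telescoped descent, second moment bound and rate. -/

section Rate

variable {Ω : Type*} [MeasurableSpace Ω] {P : Measure Ω} [IsProbabilityMeasure P]
  {d : ℕ} {f : EuclideanSpace ℝ (Fin d) → ℝ} {R₁ R₂ : ℝ} {m : ℕ} {σ γ : ℝ} {τ : ℕ → ℝ}
  {x0 : EuclideanSpace ℝ (Fin d)} {U X : ℕ → Ω → EuclideanSpace ℝ (Fin d)} {T : ℕ}

/-- A real `⨅` is a genuine lower bound only over a range bounded below; a minimizer guarantees
this. -/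
theorem iInf_le_of_minimizers_nonempty (hne : (minimizers f).Nonempty)
    (x : EuclideanSpace ℝ (Fin d)) : ⨅ u, f u ≤ f x := by
  obtain ⟨w, hw⟩ := hne
  exact ciInf_le ⟨f w, by rintro _ ⟨y, rfl⟩; exact hw y⟩ x

/-- The telescoped descent inequality along the iterates. -/
theorem IsSPB.integral_gaussianSmoothing_add_sum_le (hf : IsSPB f R₁ R₂ m) (hm : 1 ≤ m)
    (hσ : 0 < σ) (hγ : 0 < γ) (hτ : ∀ k ≤ T, τ k = γ / √((T : ℝ) + 1))
    (hU : ∀ k, Measurable (U k)) (hind : iIndepFun U P)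
    (hlaw : ∀ k, P.map (U k) = stdGaussian (EuclideanSpace ℝ (Fin d))) (h0 : ∀ ω, X 0 ω = x0)
    (hs : ∀ k ω, X (k + 1) ω = zoStep f m σ (τ k) (X k ω) (U k ω)) {n : ℕ} (hn : n ≤ T + 1) :
    ∫ ω, gaussianSmoothing f σ (X n ω) ∂P + ∑ k ∈ Finset.range n, τ k *
      ∫ ω, ‖(1 / (‖X k ω‖ ^ m + 1)) • smoothingGradient f σ (X k ω)‖ ^ 2 ∂P ≤
      (⨅ u, f u) + γ * constCtilde f m R₁ R₂ σ γ x0 := by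
  have hA := constA_nonneg (d := d) (m := m) hf.R₁_nonneg hf.R₂_pos.le hσ.le
  have hB := constB_nonneg (d := d) (m := m) hf.R₁_nonneg hσ.le
  have hC := constC_nonneg (d := d) (m := m) hf.R₁_nonneg hσ.le
  have hH2 := constH_nonneg (d := d) (m := m) (R₂ := R₂) (σ := σ) hf.R₁_nonneg 2
  have hHm := constH_nonneg (d := d) (m := m) (R₂ := R₂) (σ := σ) hf.R₁_nonneg (m + 2)
  have htel := add_sum_le_of_forall_succ_le (n := n)
    (e := fun k => ∫ ω, gaussianSmoothing f σ (X k ω) ∂P)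
    (w := fun k => τ k *
      ∫ ω, ‖(1 / (‖X k ω‖ ^ m + 1)) • smoothingGradient f σ (X k ω)‖ ^ 2 ∂P)
    (c := fun k => constH d m R₁ R₂ σ 2 * (constA d m R₁ R₂ σ + constB d m R₁ σ) / 2 * τ k ^ 2 +
      constH d m R₁ R₂ σ (m + 2) * constC d m R₁ σ / ((m : ℝ) + 2) * τ k ^ (m + 2)) fun k hk =>
    hf.integral_gaussianSmoothing_iterate_succ_le hm hσ hU hind hlaw h0 hs k
      (by rw [hτ k (by omega)]; positivity)
  have hsum := sum_constant_stepsize_le (τ := τ)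
    (c₁ := constH d m R₁ R₂ σ 2 * (constA d m R₁ R₂ σ + constB d m R₁ σ) / 2)
    (c₂ := constH d m R₁ R₂ σ (m + 2) * constC d m R₁ σ / ((m : ℝ) + 2))
    hγ (by positivity) (by positivity) hτ hn m
  have hx0 : ∫ ω, gaussianSmoothing f σ (X 0 ω) ∂P = gaussianSmoothing f σ x0 := by
    simp [h0]
  -- Replacing `f_σ x0` by `f x0` produces the term `ℳ(x0) σ` of `constCtilde`.
  have hM := (abs_le.1 (hf.abs_gaussianSmoothing_sub_le hm hσ x0)).2
  have hCt : γ * constCtilde f m R₁ R₂ σ γ x0 = f x0 - (⨅ u, f u) + constM m R₁ R₂ σ x0 * σ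
    + constH d m R₁ R₂ σ 2 * (constA d m R₁ R₂ σ + constB d m R₁ σ) / 2 * γ ^ 2
    + constH d m R₁ R₂ σ (m + 2) * constC d m R₁ σ / ((m : ℝ) + 2) * γ ^ (m + 2) := by
    rw [constCtilde, ← mul_assoc, mul_one_div_cancel hγ.ne', one_mul]
  rw [hCt]
  linarith

theorem IsSPB.integral_norm_iterate_sq_le (hf : IsSPB f R₁ R₂ m) (hm : 1 ≤ m)
    (hne : (minimizers f).Nonempty) (hbdd : Bornology.IsBounded (minimizers f))
    {μ : ℝ} (hμ : 0 < μ)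
    (hgrowth : ∀ x, f x - (⨅ u, f u) ≥ μ / 2 * Metric.infDist x (minimizers f) ^ 2)
    (hσ : 0 < σ) (hγ : 0 < γ) (hτ : ∀ k ≤ T, τ k = γ / √((T : ℝ) + 1))
    (hU : ∀ k, Measurable (U k)) (hind : iIndepFun U P)
    (hlaw : ∀ k, P.map (U k) = stdGaussian (EuclideanSpace ℝ (Fin d))) (h0 : ∀ ω, X 0 ω = x0)
    (hs : ∀ k ω, X (k + 1) ω = zoStep f m σ (τ k) (X k ω) (U k ω)) {k : ℕ} (hk : k ≤ T) :
    Integrable (fun ω => ‖X k ω‖ ^ 2) P ∧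
      ∫ ω, ‖X k ω‖ ^ 2 ∂P ≤ constMtilde f m R₁ R₂ σ γ μ x0 := by
  have hXm := hf.measurable_and_indepFun hU hind h0 hs
  have hp := hf.integrable_one_add_norm_iterate_pow hσ hU hind hlaw h0 hs k
  have hI2 : Integrable (fun ω => ‖X k ω‖ ^ 2) P :=
    integrable_comp_of_growth (hXm k).1 hp (g := fun x => ‖x‖ ^ 2) (by fun_prop) (K := 1) (N := 2)
      fun x => by
        rw [abs_of_nonneg (by positivity), one_mul]
        gcongr
        linarith
  refine ⟨hI2, ?_⟩
  have hI := hf.integrable_gaussianSmoothing_comp hσ (hXm k).1 hp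
  have hIc : Integrable (fun ω => gaussianSmoothing f σ (X k ω) - ⨅ u, f u) P :=
    hI.sub (integrable_const _)
  have hI' : Integrable (fun ω =>
      gaussianSmoothing f σ (X k ω) - (⨅ u, f u) + 1 / 2 * μ * σ ^ 2 * d) P :=
    hIc.add (integrable_const _)
  set s := ⨆ w : minimizers f, ‖(w : EuclideanSpace ℝ (Fin d))‖ ^ 2 with hsdef
  have hmono := integral_mono hI2 ((hI'.const_mul (8 * μ⁻¹)).add (integrable_const (2 * s)))
    fun ω => norm_sq_le_of_quadratic_growth hf hne hbdd hμ hgrowth hσ (X k ω)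
  have hval : ∫ ω, (gaussianSmoothing f σ (X k ω) - (⨅ u, f u) + 1 / 2 * μ * σ ^ 2 * d) ∂P =
      ∫ ω, gaussianSmoothing f σ (X k ω) ∂P - (⨅ u, f u) + 1 / 2 * μ * σ ^ 2 * d := by
    rw [integral_add hIc (integrable_const _),
      integral_sub hI (integrable_const _)]
    simp
  rw [integral_add' (hI'.const_mul _) (integrable_const _), integral_const_mul, hval,
    integral_const, probReal_univ, one_smul] at hmono
  -- Stopping the telescope at `k` and dropping the nonnegative gradient sum bounds the mean of
  -- `f_σ` at the iterate `k`.
  have htel := hf.integral_gaussianSmoothing_add_sum_le hm hσ hγ hτ hU hind hlaw h0 hs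
    (hk.trans (Nat.le_succ T))
  have hsum : 0 ≤ ∑ j ∈ Finset.range k, τ j *
      ∫ ω, ‖(1 / (‖X j ω‖ ^ m + 1)) • smoothingGradient f σ (X j ω)‖ ^ 2 ∂P := by
    refine Finset.sum_nonneg fun j hj => mul_nonneg ?_ (integral_nonneg fun ω => by positivity)
    rw [hτ j (by rw [Finset.mem_range] at hj; omega)]
    positivity
  rw [constMtilde, ← hsdef]
  refine hmono.trans ?_
  gcongr
  linarith

/-- Over `T + 1` steps the gradient sum is at least `γ √(T + 1) w`, while the final mean of `f_σ` is
at least `inf f`. -/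
theorem IsSPB.integral_norm_scaledGradient_sq_le (hf : IsSPB f R₁ R₂ m) (hm : 1 ≤ m)
    (hne : (minimizers f).Nonempty) (hσ : 0 < σ) (hγ : 0 < γ) (hT : 0 < T)
    (hτ : ∀ k ≤ T, τ k = γ / √((T : ℝ) + 1))
    (hU : ∀ k, Measurable (U k)) (hind : iIndepFun U P)
    (hlaw : ∀ k, P.map (U k) = stdGaussian (EuclideanSpace ℝ (Fin d))) (h0 : ∀ ω, X 0 ω = x0)
    (hs : ∀ k ω, X (k + 1) ω = zoStep f m σ (τ k) (X k ω) (U k ω)) {w : ℝ} (hw0 : 0 ≤ w)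
    (hw : ∀ k ≤ T, w ≤
      ∫ ω, ‖(1 / (‖X k ω‖ ^ m + 1)) • smoothingGradient f σ (X k ω)‖ ^ 2 ∂P) :
    0 ≤ constCtilde f m R₁ R₂ σ γ x0 ∧
      w ≤ constCtilde f m R₁ R₂ σ γ x0 * (T : ℝ) ^ (-(1 / 2) : ℝ) := by
  have hXm := hf.measurable_and_indepFun hU hind h0 hs
  have hp := hf.integrable_one_add_norm_iterate_pow hσ hU hind hlaw h0 hs (T + 1)
  have htel := hf.integral_gaussianSmoothing_add_sum_le hm hσ hγ hτ hU hind hlaw h0 hs le_rfl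
  have hinf : ⨅ u, f u ≤ ∫ ω, gaussianSmoothing f σ (X (T + 1) ω) ∂P := by
    have := integral_mono (integrable_const (⨅ u, f u))
      (hf.integrable_gaussianSmoothing_comp hσ (hXm (T + 1)).1 hp)
      fun ω => hf.le_gaussianSmoothing hσ.le (iInf_le_of_minimizers_nonempty hne) _
    simpa using this
  set r := √((T : ℝ) + 1) with hr
  have hr2 : r ^ 2 = (T : ℝ) + 1 := Real.sq_sqrt (by positivity)
  have hr0 : 0 < r := Real.sqrt_pos.2 (by positivity)
  have hsum : (T + 1) • (γ / r * w) ≤ ∑ k ∈ Finset.range (T + 1), τ k *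
      ∫ ω, ‖(1 / (‖X k ω‖ ^ m + 1)) • smoothingGradient f σ (X k ω)‖ ^ 2 ∂P := by
    have := Finset.card_nsmul_le_sum (Finset.range (T + 1)) (fun k => τ k *
      ∫ ω, ‖(1 / (‖X k ω‖ ^ m + 1)) • smoothingGradient f σ (X k ω)‖ ^ 2 ∂P) (γ / r * w)
      fun k hk => by
        have hk' : k ≤ T := by rw [Finset.mem_range] at hk; omega
        rw [hτ k hk']
        gcongr
        exact hw k hk'
    simpa using this
  have hmul : (T + 1) • (γ / r * w) = γ * (r * w) := by
    rw [nsmul_eq_mul, Nat.cast_add, Nat.cast_one, ← hr2]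
    field_simp
  have hrw : r * w ≤ constCtilde f m R₁ R₂ σ γ x0 := by
    refine le_of_mul_le_mul_left ?_ hγ
    linarith
  refine ⟨(mul_nonneg hr0.le hw0).trans hrw, ?_⟩
  have hT' : (0 : ℝ) < T := by exact_mod_cast hT
  rw [Real.rpow_neg hT'.le, ← Real.sqrt_eq_rpow, ← div_eq_mul_inv, le_div_iff₀ (by positivity),
    mul_comm]
  refine (mul_le_mul_of_nonneg_right ?_ hw0).trans hrw
  exact Real.sqrt_le_sqrt (by linarith)

theorem IsSPB.integral_norm_smoothingGradient_rpow_le (hf : IsSPB f R₁ R₂ m) (hm : 1 ≤ m)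
    (hσ : 0 < σ) {Y : Ω → EuclideanSpace ℝ (Fin d)} (hY : Measurable Y)
    (hp : ∀ p : ℕ, Integrable (fun ω => (1 + ‖Y ω‖) ^ p) P) {q M : ℝ} (hq : 0 < q)
    (hmq : m * q ≤ 1) (hI2 : Integrable (fun ω => ‖Y ω‖ ^ 2) P) (hM : ∫ ω, ‖Y ω‖ ^ 2 ∂P ≤ M) :
    ∫ ω, ‖smoothingGradient f σ (Y ω)‖ ^ q ∂P ≤
      (∫ ω, ‖(1 / (‖Y ω‖ ^ m + 1)) • smoothingGradient f σ (Y ω)‖ ^ 2 ∂P) ^ (q / 2) *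
        (2 ^ q * (1 + √M)) := by
  have hm' : (1 : ℝ) ≤ m := by exact_mod_cast hm
  have hq1 : q ≤ 1 := (le_mul_of_one_le_left hq.le hm').trans hmq
  have hM0 : 0 ≤ M := (integral_nonneg fun ω => by positivity).trans hM
  have hdom : Integrable (fun ω => ((2 : ℝ) ^ q) ^ 2 * (1 + ‖Y ω‖ ^ 2)) P :=
    ((integrable_const 1).add hI2).const_mul _
  have hbm : Measurable fun ω => ‖Y ω‖ ^ m + 1 := by fun_prop
  have hb : Integrable (fun ω => (‖Y ω‖ ^ m + 1) ^ (2 * q)) P := by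
    refine hdom.mono' (hbm.pow_const _).aestronglyMeasurable (Eventually.of_forall fun ω => ?_)
    rw [Real.norm_of_nonneg (by positivity)]
    exact norm_pow_add_one_rpow_le (Y ω) hq.le hmq
  have hH := integral_mul_rpow_le (P := P)
    (a := fun ω => ‖(1 / (‖Y ω‖ ^ m + 1)) • smoothingGradient f σ (Y ω)‖)
    (b := fun ω => ‖Y ω‖ ^ m + 1) (fun ω => norm_nonneg _) (fun ω => by positivity)
    ((hf.continuous_scaledGradient hm hσ).norm.measurable.comp hY) hbm hq hq1
    (hf.integrable_norm_scaledGradient_sq hm hσ hY hp) hb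
  have heq : ∀ ω, ‖(1 / (‖Y ω‖ ^ m + 1)) • smoothingGradient f σ (Y ω)‖ * (‖Y ω‖ ^ m + 1) =
      ‖smoothingGradient f σ (Y ω)‖ := fun ω => by
    have : ‖Y ω‖ ^ m + 1 ≠ 0 := by positivity
    rw [norm_smul, Real.norm_of_nonneg (by positivity)]
    field_simp
  simp only [heq] at hH
  refine hH.trans ?_
  gcongr
  refine Real.sqrt_le_iff.2 ⟨by positivity, ?_⟩
  calc ∫ ω, (‖Y ω‖ ^ m + 1) ^ (2 * q) ∂P ≤ ∫ ω, ((2 : ℝ) ^ q) ^ 2 * (1 + ‖Y ω‖ ^ 2) ∂P :=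
        integral_mono hb hdom fun ω => norm_pow_add_one_rpow_le (Y ω) hq.le hmq
    _ = ((2 : ℝ) ^ q) ^ 2 * (1 + ∫ ω, ‖Y ω‖ ^ 2 ∂P) := by
        rw [integral_const_mul, integral_add (integrable_const _) hI2]
        simp
    _ ≤ ((2 : ℝ) ^ q) ^ 2 * (1 + √M) ^ 2 := by
        gcongr
        nlinarith [Real.sq_sqrt hM0, Real.sqrt_nonneg M]
    _ = _ := by rw [mul_pow]

end Rate

theorem corollary4p10 {d : ℕ} (f : EuclideanSpace ℝ (Fin d) → ℝ) (R₁ R₂ : ℝ) (m : ℕ)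
    (hm : 1 ≤ m) (hf : IsSPB f R₁ R₂ m)
    (hne : (minimizers f).Nonempty) (hbdd : Bornology.IsBounded (minimizers f))
    (μ : ℝ) (hμ : 0 < μ)
    (hgrowth : ∀ x, f x - (⨅ u, f u) ≥ μ / 2 * Metric.infDist x (minimizers f) ^ 2)
    (σ : ℝ) (hσ : 0 < σ) (γ : ℝ) (hγ : 0 < γ) (hγ1 : γ ≤ 1) (T : ℕ) (hT : 0 < T)
    (τ : ℕ → ℝ) (hτ : ∀ k ≤ T, τ k = γ / √((T : ℝ) + 1))
    (x0 : EuclideanSpace ℝ (Fin d))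
    -- the random directions: independent standard Gaussian vectors
    {Ω : Type*} [MeasurableSpace Ω] (P : Measure Ω) [IsProbabilityMeasure P]
    (U : ℕ → Ω → EuclideanSpace ℝ (Fin d)) (hUmeas : ∀ k, Measurable (U k))
    (hUlaw : ∀ k, P.map (U k) = stdGaussian (EuclideanSpace ℝ (Fin d)))
    (hUindep : iIndepFun U P)
    -- the random iterates
    (X : ℕ → Ω → EuclideanSpace ℝ (Fin d))
    (hX : ∀ k ω, X k ω = zoIterate f m σ τ x0 (fun j => U j ω) k)
    (wsq : ℕ → ℝ)
    (hwsq : ∀ k, wsq k =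
      ∫ ω, ‖(1 / (‖X k ω‖ ^ m + 1)) • gradient (gaussianSmoothing f σ) (X k ω)‖ ^ 2 ∂P) :
    -- the Gaussian smoothing and its gradient are well defined
    (∀ x, Integrable (fun u => f (x + σ • u)) (stdGaussian (EuclideanSpace ℝ (Fin d))) ∧
      Integrable (fun u => f (x + σ • u) • u) (stdGaussian (EuclideanSpace ℝ (Fin d))) ∧
      HasGradientAt (gaussianSmoothing f σ)
        (σ⁻¹ • ∫ u, f (x + σ • u) • u ∂(stdGaussian (EuclideanSpace ℝ (Fin d)))) x) ∧
    -- the expectations below are finite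
    (∀ k ≤ T,
      Integrable (fun ω => ‖X k ω‖ ^ 2) P ∧
      Integrable (fun ω =>
        ‖(1 / (‖X k ω‖ ^ m + 1)) • gradient (gaussianSmoothing f σ) (X k ω)‖ ^ 2) P ∧
      Integrable (fun ω =>
        ‖gradient (gaussianSmoothing f σ) (X k ω)‖ ^ (1 / (2 * (⌈(m : ℝ) / 2⌉₊ : ℝ)))) P) ∧
    -- the second moment bound
    (∀ kstar ≤ T, (∀ k ≤ T, wsq kstar ≤ wsq k) →
      ∫ ω, ‖X kstar ω‖ ^ 2 ∂P ≤ constMtilde f m R₁ R₂ σ γ μ x0) ∧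
    -- the rate
    (Finset.range (T + 1)).inf' Finset.nonempty_range_add_one (fun k =>
        ∫ ω, ‖gradient (gaussianSmoothing f σ) (X k ω)‖ ^ (1 / (2 * (⌈(m : ℝ) / 2⌉₊ : ℝ))) ∂P)
      ≤ (2 : ℝ) ^ (1 / (2 * (⌈(m : ℝ) / 2⌉₊ : ℝ)))
        * (1 + √(constMtilde f m R₁ R₂ σ γ μ x0))
        * constCtilde f m R₁ R₂ σ γ x0 ^ (1 / (4 * (⌈(m : ℝ) / 2⌉₊ : ℝ)))
        * (T : ℝ) ^ (-(1 / (8 * (⌈(m : ℝ) / 2⌉₊ : ℝ)))) := by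
  have h0 : ∀ ω, X 0 ω = x0 := fun ω => hX 0 ω
  have hs : ∀ k ω, X (k + 1) ω = zoStep f m σ (τ k) (X k ω) (U k ω) := fun k ω => by
    rw [hX (k + 1), hX k]
    rfl
  simp only [hf.gradient_gaussianSmoothing hσ] at hwsq ⊢
  have hXm := hf.measurable_and_indepFun hUmeas hUindep h0 hs
  have hp := hf.integrable_one_add_norm_iterate_pow hσ hUmeas hUindep hUlaw h0 hs
  have hsecond : ∀ k ≤ T, _ := fun k hk => hf.integral_norm_iterate_sq_le hm hne hbdd hμ hgrowth hσ
    hγ hτ hUmeas hUindep hUlaw h0 hs hk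
  have hm' : (1 : ℝ) ≤ m := by exact_mod_cast hm
  set n : ℝ := (⌈(m : ℝ) / 2⌉₊ : ℝ) with hn
  have hmn : (m : ℝ) / 2 ≤ n := Nat.le_ceil _
  have hn0 : 0 < n := by linarith
  set q : ℝ := 1 / (2 * n) with hq
  have hq0 : 0 < q := by positivity
  have hmq : m * q ≤ 1 := by
    rw [hq, mul_one_div, div_le_one (by positivity)]
    linarith
  have hq1 : q ≤ 1 := (le_mul_of_one_le_left hq0.le hm').trans hmq
  refine ⟨fun x => ⟨hf.integrable_add_smul hσ.le x, hf.integrable_add_smul_smul hσ.le x,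
    hf.hasGradientAt_gaussianSmoothing hσ x⟩, fun k hk => ⟨(hsecond k hk).1,
    hf.integrable_norm_scaledGradient_sq hm hσ (hXm k).1 (hp k),
    hf.integrable_norm_smoothingGradient_rpow hm hσ (hXm k).1 (hp k) hq0.le hq1⟩,
    fun k hk _ => (hsecond k hk).2, ?_⟩
  -- The index minimising the scaled quantity serves as witness: the minimum in the rate is at most
  -- its value there.
  obtain ⟨k, hk, hmin⟩ := Finset.exists_min_image (Finset.range (T + 1)) wsq
    Finset.nonempty_range_add_one
  have hkT : k ≤ T := Nat.lt_succ_iff.1 (Finset.mem_range.1 hk)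
  have hw0 : 0 ≤ wsq k := by
    rw [hwsq]
    exact integral_nonneg fun ω => by positivity
  obtain ⟨hC0, hwle⟩ := hf.integral_norm_scaledGradient_sq_le hm hne hσ hγ hT hτ hUmeas hUindep
    hUlaw h0 hs hw0 fun j hj => by
      rw [← hwsq]
      exact hmin j (Finset.mem_range.2 (Nat.lt_succ_iff.2 hj))
  have hfrac := hf.integral_norm_smoothingGradient_rpow_le hm hσ (hXm k).1 (hp k) hq0 hmq
    (hsecond k hkT).1 (hsecond k hkT).2
  rw [← hwsq] at hfrac
  refine (Finset.inf'_le _ hk).trans (hfrac.trans ?_)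
  have hpow : wsq k ^ (q / 2) ≤ constCtilde f m R₁ R₂ σ γ x0 ^ (1 / (4 * n)) *
      (T : ℝ) ^ (-(1 / (8 * n))) := by
    -- The exponents are `q / 2 = 1 / (4 n)` and `-(1 / 2) * (q / 2) = -1 / (8 n)`.
    refine (Real.rpow_le_rpow hw0 hwle (by positivity)).trans (le_of_eq ?_)
    rw [Real.mul_rpow hC0 (by positivity), ← Real.rpow_mul (Nat.cast_nonneg T), hq]
    congr 2
    · field_simp
      norm_num
    · field_simp
      norm_num
  calc _ ≤ constCtilde f m R₁ R₂ σ γ x0 ^ (1 / (4 * n)) * (T : ℝ) ^ (-(1 / (8 * n))) *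
        (2 ^ q * (1 + √(constMtilde f m R₁ R₂ σ γ μ x0))) := by gcongr
    _ = _ := by ring
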